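/- All $C^*$-algebras are unital. A state preserving $C^*$-dynamical system $(\mathfrak A,\varphi,T)$ consists of a $C^*$-algebra $\mathfrak A$, a unital completely positive map $T:\mathfrak A\to\mathfrak A$ and a state $\varphi$ of $\mathfrak A$ with $\varphi\circ T=\varphi$. It is called uniquely ergodic if $\varphi$ is the only $T$-invariant state of $\mathfrak A$, and strictly weak mixing if $$\lim_{n\to\infty}\frac1n\sum_{k=0}^{n-1}\bigl|\psi(T^k(x))-\psi(\mathbf 1)\varphi(x)\bigr|=0\qquad\text{for all }x\in\mathfrak A,\ \psi\in\mathfrak A^*.$$ For $C^*$-algebras $\mathfrak A,\mathfrak B$, let $\mathfrak A\otimes\mathfrak B$ be the minimal $C^*$-tensor product, let $T\otimes H$ be the unital completely positive map on it determined by $(T\otimes H)(x\otimes y)=T(x)\otimes H(y)$, and let $\varphi\otimes\varphi_1$ be the product state. Write $\mathfrak A^*\otimes\mathfrak B^*$ for the norm closure in $(\mathfrak A\otimes\mathfrak B)^*$ of the linear span of the product functionals $\psi\otimes\chi$, $\psi\in\mathfrak A^*$, $\chi\in\mathfrak B^*$. Theorem. Let $(\mathfrak A,\varphi,T)$ be a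 state preserving $C^*$-dynamical system, and consider the following assertions. (i) For every uniquely ergodic state preserving $C^*$-dynamical system $(\mathfrak B,\varphi_1,H)$, the state preserving $C^*$-dynamical system $(\mathfrak A\otimes\mathfrak B,\varphi\otimes\varphi_1,T\otimes H)$ is uniquely ergodic. (ii) $(\mathfrak A,\varphi,T)$ is strictly weak mixing. (iii) For every uniquely ergodic state preserving $C^*$-dynamical system $(\mathfrak B,\varphi_1,H)$ such that $\mathfrak A^*\otimes\mathfrak B^*=(\mathfrak A\otimes\mathfrak B)^*$, the state preserving $C^*$-dynamical system $(\mathfrak A\otimes\mathfrak B,\varphi\otimes\varphi_1,T\otimes H)$ is uniquely ergodic. Then (i)$\Rightarrow$(ii)$\Rightarrow$(iii). -/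

import Mathlib

open scoped TensorProduct InnerProductSpace ComplexOrder
open UniformSpace Filter Topology

universe u v

namespace CStarDyn

section HilbertTensor

variable (H : Type u) (K : Type v) [NormedAddCommGroup H] [InnerProductSpace ℂ H]
  [NormedAddCommGroup K] [InnerProductSpace ℂ K]

/-- The Hilbert space tensor product: the completion of the algebraic one. -/
def HilbertTensor : Type (max u v) := Completion (H ⊗[ℂ] K)

noncomputable instance : NormedAddCommGroup (HilbertTensor H K) :=
  inferInstanceAs (NormedAddCommGroup (Completion (H ⊗[ℂ] K)))
noncomputable instance : InnerProductSpace ℂ (HilbertTensor H K) :=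
  inferInstanceAs (InnerProductSpace ℂ (Completion (H ⊗[ℂ] K)))
instance : CompleteSpace (HilbertTensor H K) :=
  inferInstanceAs (CompleteSpace (Completion (H ⊗[ℂ] K)))

/-- The inclusion of the algebraic tensor product in the Hilbert space tensor product. -/
noncomputable def HilbertTensor.incl : H ⊗[ℂ] K →ₗᵢ[ℂ] HilbertTensor H K :=
  Completion.toComplₗᵢ (𝕜 := ℂ) (E := H ⊗[ℂ] K)

theorem HilbertTensor.denseRange_incl : DenseRange (HilbertTensor.incl H K) :=
  Completion.denseRange_coe

variable {H K}

/-- The operator `f ⊗ g` on the Hilbert space tensor product. -/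
noncomputable def HilbertTensor.map (f : H →L[ℂ] H) (g : K →L[ℂ] K) :
    HilbertTensor H K →L[ℂ] HilbertTensor H K :=
  (TensorProduct.mapL f g).completion

theorem HilbertTensor.map_incl (f : H →L[ℂ] H) (g : K →L[ℂ] K) (x : H ⊗[ℂ] K) :
    HilbertTensor.map f g (HilbertTensor.incl H K x) =
      HilbertTensor.incl H K (TensorProduct.mapL f g x) :=
  ContinuousLinearMap.completion_apply_coe _ _

theorem HilbertTensor.ext_clm {S R : HilbertTensor H K →L[ℂ] HilbertTensor H K}
    (h : ∀ x, S (HilbertTensor.incl H K x) = R (HilbertTensor.incl H K x)) : S = R :=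
  ContinuousLinearMap.coeFn_injective
    ((HilbertTensor.denseRange_incl H K).equalizer S.continuous R.continuous (funext h))

theorem HilbertTensor.opNorm_le {S : HilbertTensor H K →L[ℂ] HilbertTensor H K} {C : ℝ}
    (hC : 0 ≤ C) (h : ∀ x, ‖S (HilbertTensor.incl H K x)‖ ≤ C * ‖x‖) : ‖S‖ ≤ C := by
  refine ContinuousLinearMap.opNorm_le_bound _ hC fun y => ?_
  induction y using (HilbertTensor.denseRange_incl H K).induction_on with
  | hp => exact isClosed_le (by fun_prop) (by fun_prop)
  | ih x => rw [LinearIsometry.norm_map]; exact h x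

theorem HilbertTensor.norm_map_le (f : H →L[ℂ] H) (g : K →L[ℂ] K) :
    ‖HilbertTensor.map f g‖ ≤ ‖f‖ * ‖g‖ := by
  refine HilbertTensor.opNorm_le (by positivity) fun x => ?_
  rw [HilbertTensor.map_incl, LinearIsometry.norm_map]
  refine (ContinuousLinearMap.le_opNorm _ _).trans ?_
  gcongr
  exact TensorProduct.norm_mapL_le _ _

theorem HilbertTensor.map_star [CompleteSpace H] [CompleteSpace K] (f : H →L[ℂ] H)
    (g : K →L[ℂ] K) :
    HilbertTensor.map (star f) (star g) = star (HilbertTensor.map f g) := by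
  have key : ∀ x y : H ⊗[ℂ] K, ⟪TensorProduct.mapL (star f) (star g) x, y⟫_ℂ =
      ⟪x, TensorProduct.mapL f g y⟫_ℂ := by
    intro x y
    induction x with
    | zero => simp
    | add x x' hx hx' => rw [map_add, inner_add_left, inner_add_left, hx, hx']
    | tmul h k =>
      induction y with
      | zero => simp
      | add y y' hy hy' => rw [map_add, inner_add_right, inner_add_right, hy, hy']
      | tmul h' k' =>
        rw [TensorProduct.mapL_tmul, TensorProduct.mapL_tmul, TensorProduct.inner_tmul,
          TensorProduct.inner_tmul, ContinuousLinearMap.star_eq_adjoint,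
          ContinuousLinearMap.star_eq_adjoint, ContinuousLinearMap.adjoint_inner_left,
          ContinuousLinearMap.adjoint_inner_left]
  rw [ContinuousLinearMap.star_eq_adjoint (HilbertTensor.map f g),
    ContinuousLinearMap.eq_adjoint_iff]
  intro x y
  induction x, y using (HilbertTensor.denseRange_incl H K).induction_on₂ with
  | hp => exact isClosed_eq (by fun_prop) (by fun_prop)
  | h x y =>
    rw [HilbertTensor.map_incl, HilbertTensor.map_incl, LinearIsometry.inner_map_map,
      LinearIsometry.inner_map_map, key]

end HilbertTensor

/-- A (unital) representation of a unital C*-algebra on a complex Hilbert space. -/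
structure HilbertRep (A : Type u) [CStarAlgebra A] where
  space : Type u
  [normed : NormedAddCommGroup space]
  [inner : InnerProductSpace ℂ space]
  [complete : CompleteSpace space]
  rep : A →⋆ₐ[ℂ] (space →L[ℂ] space)

attribute [instance] HilbertRep.normed HilbertRep.inner HilbertRep.complete

section Algebraic

variable {A : Type u} {B : Type v} [CStarAlgebra A] [CStarAlgebra B]

/-- The linear map `a ⊗ b ↦ π(a) ⊗ σ(b)`. -/
noncomputable def HilbertRep.tensorLin (π : HilbertRep A) (σ : HilbertRep B) :
    A ⊗[ℂ] B →ₗ[ℂ] (HilbertTensor π.space σ.space →L[ℂ] HilbertTensor π.space σ.space) :=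
  TensorProduct.lift (LinearMap.mk₂ ℂ
    (fun a b => HilbertTensor.map (π.rep a) (σ.rep b))
    (fun a a' b => HilbertTensor.ext_clm fun x => by
      rw [add_apply, HilbertTensor.map_incl, HilbertTensor.map_incl,
        HilbertTensor.map_incl, _root_.map_add, TensorProduct.mapL_add_left,
        add_apply, _root_.map_add])
    (fun c a b => HilbertTensor.ext_clm fun x => by
      rw [smul_apply, HilbertTensor.map_incl, HilbertTensor.map_incl,
        _root_.map_smul, TensorProduct.mapL_smul_left, smul_apply,
        _root_.map_smul])
    (fun a b b' => HilbertTensor.ext_clm fun x => by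
      rw [add_apply, HilbertTensor.map_incl, HilbertTensor.map_incl,
        HilbertTensor.map_incl, _root_.map_add, TensorProduct.mapL_add_right,
        add_apply, _root_.map_add])
    (fun c a b => HilbertTensor.ext_clm fun x => by
      rw [smul_apply, HilbertTensor.map_incl, HilbertTensor.map_incl,
        _root_.map_smul, TensorProduct.mapL_smul_right, smul_apply,
        _root_.map_smul]))

theorem HilbertRep.tensorLin_tmul (π : HilbertRep A) (σ : HilbertRep B) (a : A) (b : B) :
    π.tensorLin σ (a ⊗ₜ b) = HilbertTensor.map (π.rep a) (σ.rep b) := rfl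

/-- The tensor product of two representations, as a `*`-homomorphism from the algebraic tensor
product to the bounded operators on the Hilbert space tensor product. -/
noncomputable def HilbertRep.tensor (π : HilbertRep A) (σ : HilbertRep B) :
    A ⊗[ℂ] B →⋆ₐ[ℂ] (HilbertTensor π.space σ.space →L[ℂ] HilbertTensor π.space σ.space) where
  __ := Algebra.TensorProduct.algHomOfLinearMapTensorProduct (π.tensorLin σ)
    (fun a a' b b' => HilbertTensor.ext_clm fun x => by
      rw [mul_apply_eq_comp, HilbertRep.tensorLin_tmul,
        HilbertRep.tensorLin_tmul, HilbertRep.tensorLin_tmul, HilbertTensor.map_incl,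
        HilbertTensor.map_incl, HilbertTensor.map_incl, map_mul, map_mul,
        TensorProduct.mapL_mul, mul_apply_eq_comp])
    (HilbertTensor.ext_clm fun x => by
      rw [HilbertRep.tensorLin_tmul, map_one, map_one, HilbertTensor.map_incl,
        one_apply_eq_self]
      congr 1
      exact DFunLike.congr_fun TensorProduct.mapL_id_id x)
  map_star' z := by
    change π.tensorLin σ (star z) = star (π.tensorLin σ z)
    induction z with
    | zero => simp
    | add x y hx hy => rw [star_add, map_add, map_add, star_add, hx, hy]
    | tmul a b =>
      rw [TensorProduct.star_tmul, HilbertRep.tensorLin_tmul, HilbertRep.tensorLin_tmul,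
        map_star, map_star, HilbertTensor.map_star]

theorem HilbertRep.tensor_tmul (π : HilbertRep A) (σ : HilbertRep B) (a : A) (b : B) :
    π.tensor σ (a ⊗ₜ b) = HilbertTensor.map (π.rep a) (σ.rep b) := rfl

/-- The minimal (spatial) C*-norm on the algebraic tensor product: the supremum of
`‖(π ⊗ σ)(z)‖` over all representations `π` of `A` and `σ` of `B`. -/
noncomputable def minNorm (z : A ⊗[ℂ] B) : ℝ :=
  ⨆ p : HilbertRep A × HilbertRep B, ‖p.1.tensor p.2 z‖

theorem bddAbove_norm_tensor (z : A ⊗[ℂ] B) :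
    BddAbove (Set.range fun p : HilbertRep A × HilbertRep B => ‖p.1.tensor p.2 z‖) := by
  suffices h : ∃ C : ℝ, ∀ p : HilbertRep A × HilbertRep B, ‖p.1.tensor p.2 z‖ ≤ C by
    obtain ⟨C, hC⟩ := h
    exact ⟨C, by rintro _ ⟨p, rfl⟩; exact hC p⟩
  induction z with
  | zero => exact ⟨0, fun p => by rw [map_zero, norm_zero]⟩
  | add x y hx hy =>
    obtain ⟨C, hC⟩ := hx
    obtain ⟨D, hD⟩ := hy
    refine ⟨C + D, fun p => ?_⟩
    rw [map_add]
    exact (norm_add_le _ _).trans (add_le_add (hC p) (hD p))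
  | tmul a b =>
    refine ⟨‖a‖ * ‖b‖, fun p => ?_⟩
    rw [HilbertRep.tensor_tmul]
    refine (HilbertTensor.norm_map_le _ _).trans ?_
    gcongr
    · exact NonUnitalStarAlgHom.norm_apply_le p.1.rep a
    · exact NonUnitalStarAlgHom.norm_apply_le p.2.rep b

theorem norm_tensor_le_minNorm (π : HilbertRep A) (σ : HilbertRep B) (z : A ⊗[ℂ] B) :
    ‖π.tensor σ z‖ ≤ minNorm z :=
  le_ciSup (bddAbove_norm_tensor z) (π, σ)

theorem minNorm_nonneg (z : A ⊗[ℂ] B) : 0 ≤ minNorm z :=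
  Real.iSup_nonneg fun _ => norm_nonneg _

theorem minNorm_le {z : A ⊗[ℂ] B} {C : ℝ} (hC : 0 ≤ C)
    (h : ∀ (π : HilbertRep A) (σ : HilbertRep B), ‖π.tensor σ z‖ ≤ C) : minNorm z ≤ C :=
  Real.iSup_le (fun p => h p.1 p.2) hC

theorem minNorm_mul_le (x y : A ⊗[ℂ] B) : minNorm (x * y) ≤ minNorm x * minNorm y := by
  refine minNorm_le (mul_nonneg (minNorm_nonneg x) (minNorm_nonneg y)) fun π σ => ?_
  rw [map_mul]
  exact (norm_mul_le _ _).trans (mul_le_mul (norm_tensor_le_minNorm π σ x)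
    (norm_tensor_le_minNorm π σ y) (norm_nonneg _) (minNorm_nonneg x))

theorem minNorm_star (x : A ⊗[ℂ] B) : minNorm (star x) = minNorm x := by
  simp only [minNorm, map_star, norm_star]

theorem minNorm_mul_self_le (x : A ⊗[ℂ] B) : minNorm x * minNorm x ≤ minNorm (star x * x) := by
  have h0 := minNorm_nonneg (star x * x)
  have h : minNorm x ≤ √(minNorm (star x * x)) := by
    refine minNorm_le (Real.sqrt_nonneg _) fun π σ => Real.le_sqrt_of_sq_le ?_
    rw [sq, ← CStarRing.norm_star_mul_self, ← map_star, ← map_mul]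
    exact norm_tensor_le_minNorm π σ _
  calc minNorm x * minNorm x ≤ √(minNorm (star x * x)) * √(minNorm (star x * x)) :=
        mul_le_mul h h (minNorm_nonneg x) (Real.sqrt_nonneg _)
    _ = minNorm (star x * x) := Real.mul_self_sqrt h0

theorem minNorm_core : (∀ x : A ⊗[ℂ] B, 0 ≤ minNorm x) ∧
    (∀ (c : ℂ) (x : A ⊗[ℂ] B), minNorm (c • x) = ‖c‖ * minNorm x) ∧
    ∀ x y : A ⊗[ℂ] B, minNorm (x + y) ≤ minNorm x + minNorm y := by
  refine ⟨minNorm_nonneg, fun c x => ?_, fun x y => ?_⟩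
  · simp only [minNorm, map_smul, norm_smul]
    rw [Real.mul_iSup_of_nonneg (norm_nonneg c)]
  · refine minNorm_le (add_nonneg (minNorm_nonneg x) (minNorm_nonneg y)) fun π σ => ?_
    rw [map_add]
    exact (norm_add_le _ _).trans
      (add_le_add (norm_tensor_le_minNorm π σ x) (norm_tensor_le_minNorm π σ y))

end Algebraic

section MinTensor

variable (A : Type u) (B : Type v) [CStarAlgebra A] [CStarAlgebra B]

/-- The algebraic tensor product, (semi)normed by the minimal C*-norm. -/
def AlgTensor : Type (max u v) := A ⊗[ℂ] B

noncomputable instance : Ring (AlgTensor A B) := inferInstanceAs (Ring (A ⊗[ℂ] B))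
noncomputable instance : Algebra ℂ (AlgTensor A B) := inferInstanceAs (Algebra ℂ (A ⊗[ℂ] B))
noncomputable instance : StarRing (AlgTensor A B) := inferInstanceAs (StarRing (A ⊗[ℂ] B))
instance : StarModule ℂ (AlgTensor A B) := inferInstanceAs (StarModule ℂ (A ⊗[ℂ] B))

noncomputable instance : Norm (AlgTensor A B) := ⟨minNorm (A := A) (B := B)⟩

theorem AlgTensor.core : SeminormedSpace.Core ℂ (AlgTensor A B) where
  norm_nonneg := (minNorm_core (A := A) (B := B)).1
  norm_smul := (minNorm_core (A := A) (B := B)).2.1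
  norm_triangle := (minNorm_core (A := A) (B := B)).2.2

noncomputable instance : SeminormedRing (AlgTensor A B) :=
  { (inferInstance : Ring (AlgTensor A B)),
    SeminormedAddCommGroup.ofCore (AlgTensor.core A B) with
    norm_mul_le := minNorm_mul_le (A := A) (B := B) }

noncomputable instance : NormedAlgebra ℂ (AlgTensor A B) where
  norm_smul_le c x := (AlgTensor.core A B).norm_smul c x |>.le

instance : NormedStarGroup (AlgTensor A B) where
  norm_star_le x := (minNorm_star (A := A) (B := B) x).le

/-- The minimal C*-tensor product: the completion of the algebraic tensor product with respect to
the minimal C*-norm. -/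
def MinTensor : Type (max u v) := Completion (AlgTensor A B)

noncomputable instance : NormedRing (MinTensor A B) :=
  inferInstanceAs (NormedRing (Completion (AlgTensor A B)))
instance : CompleteSpace (MinTensor A B) :=
  inferInstanceAs (CompleteSpace (Completion (AlgTensor A B)))
noncomputable instance : Algebra ℂ (MinTensor A B) :=
  inferInstanceAs (Algebra ℂ (Completion (AlgTensor A B)))


/-- The inclusion of the algebraic tensor product, as a map of rings. -/
noncomputable def MinTensor.inclRing : A ⊗[ℂ] B →+* MinTensor A B :=
  (Completion.coeRingHom : AlgTensor A B →+* Completion (AlgTensor A B))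

theorem MinTensor.denseRange_inclRing : DenseRange (MinTensor.inclRing A B) :=
  Completion.denseRange_coe (α := AlgTensor A B)

theorem MinTensor.norm_inclRing (z : A ⊗[ℂ] B) : ‖MinTensor.inclRing A B z‖ = minNorm z :=
  Completion.norm_coe (E := AlgTensor A B) z

noncomputable instance : Star (MinTensor A B) :=
  ⟨Completion.map (star : AlgTensor A B → AlgTensor A B)⟩

theorem MinTensor.star_inclRing (z : A ⊗[ℂ] B) :
    star (MinTensor.inclRing A B z) = MinTensor.inclRing A B (star z) :=
  Completion.map_coe (α := AlgTensor A B) (β := AlgTensor A B)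
    star_isometry.uniformContinuous z

theorem MinTensor.continuous_star : Continuous (star : MinTensor A B → MinTensor A B) :=
  Completion.continuous_map (α := AlgTensor A B) (β := AlgTensor A B)

noncomputable instance : StarRing (MinTensor A B) where
  star_involutive x := by
    have hs := MinTensor.continuous_star A B
    induction x using (MinTensor.denseRange_inclRing A B).induction_on with
    | hp => exact isClosed_eq (by fun_prop) (by fun_prop)
    | ih x => rw [MinTensor.star_inclRing, MinTensor.star_inclRing, star_star]
  star_mul x y := by
    have hs := MinTensor.continuous_star A B
    induction x, y using (MinTensor.denseRange_inclRing A B).induction_on₂ with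
    | hp => exact isClosed_eq (by fun_prop) (by fun_prop)
    | h x y =>
      rw [← map_mul, MinTensor.star_inclRing, MinTensor.star_inclRing, MinTensor.star_inclRing,
        ← map_mul, star_mul]
  star_add x y := by
    have hs := MinTensor.continuous_star A B
    induction x, y using (MinTensor.denseRange_inclRing A B).induction_on₂ with
    | hp => exact isClosed_eq (by fun_prop) (by fun_prop)
    | h x y =>
      rw [← map_add, MinTensor.star_inclRing, MinTensor.star_inclRing, MinTensor.star_inclRing,
        ← map_add, star_add]

theorem MinTensor.algebraMap_eq (c : ℂ) :
    algebraMap ℂ (MinTensor A B) c = MinTensor.inclRing A B (algebraMap ℂ (A ⊗[ℂ] B) c) := rfl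

theorem MinTensor.smul_inclRing (c : ℂ) (z : A ⊗[ℂ] B) :
    c • MinTensor.inclRing A B z = MinTensor.inclRing A B (c • z) :=
  by rw [Algebra.smul_def, Algebra.smul_def, map_mul, MinTensor.algebraMap_eq]

theorem MinTensor.continuous_smul (c : ℂ) : Continuous fun x : MinTensor A B => c • x := by
  simp only [Algebra.smul_def]
  exact continuous_const.mul continuous_id

noncomputable instance : NormedAlgebra ℂ (MinTensor A B) where
  norm_smul_le c x := by
    induction x using (MinTensor.denseRange_inclRing A B).induction_on with
    | hp => exact isClosed_le (MinTensor.continuous_smul A B c).norm (continuous_const.mul continuous_norm)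
    | ih x =>
      rw [MinTensor.smul_inclRing, MinTensor.norm_inclRing, MinTensor.norm_inclRing,
        (minNorm_core (A := A) (B := B)).2.1]

instance : CStarRing (MinTensor A B) where
  norm_mul_self_le x := by
    have hs := MinTensor.continuous_star A B
    induction x using (MinTensor.denseRange_inclRing A B).induction_on with
    | hp => exact isClosed_le (by fun_prop) (by fun_prop)
    | ih x =>
      rw [MinTensor.star_inclRing, ← map_mul, MinTensor.norm_inclRing, MinTensor.norm_inclRing]
      exact minNorm_mul_self_le x

instance : StarModule ℂ (MinTensor A B) where
  star_smul c x := by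
    have hs := MinTensor.continuous_star A B
    induction x using (MinTensor.denseRange_inclRing A B).induction_on with
    | hp =>
      exact isClosed_eq (hs.comp (MinTensor.continuous_smul A B c))
        ((MinTensor.continuous_smul A B (star c)).comp hs)
    | ih x =>
      rw [MinTensor.smul_inclRing, MinTensor.star_inclRing, MinTensor.star_inclRing,
        MinTensor.smul_inclRing, star_smul]

noncomputable instance : CStarAlgebra (MinTensor A B) where

noncomputable instance : PartialOrder (MinTensor A B) := CStarAlgebra.spectralOrder _
instance : StarOrderedRing (MinTensor A B) := CStarAlgebra.spectralOrderedRing _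

/-- The canonical `*`-homomorphism from the algebraic to the minimal tensor product. -/
noncomputable def MinTensor.incl : A ⊗[ℂ] B →⋆ₐ[ℂ] MinTensor A B where
  __ := MinTensor.inclRing A B
  commutes' c := by
    change MinTensor.inclRing A B (algebraMap ℂ (A ⊗[ℂ] B) c) = _
    rw [Algebra.algebraMap_eq_smul_one, Algebra.algebraMap_eq_smul_one,
      ← MinTensor.smul_inclRing, map_one]
  map_star' z := (MinTensor.star_inclRing A B z).symm

theorem MinTensor.denseRange_incl : DenseRange (MinTensor.incl A B) :=
  MinTensor.denseRange_inclRing A B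

variable {A B}

theorem MinTensor.norm_incl (z : A ⊗[ℂ] B) : ‖MinTensor.incl A B z‖ = minNorm z :=
  MinTensor.norm_inclRing A B z

/-- The elementary tensor `a ⊗ b` in the minimal tensor product. -/
noncomputable def MinTensor.tmul (a : A) (b : B) : MinTensor A B :=
  MinTensor.incl A B (a ⊗ₜ[ℂ] b)

/-- A linear map which is contractive for the minimal norm, as a continuous linear map. -/
noncomputable def AlgTensor.mkCLM {E : Type*} [NormedAddCommGroup E] [NormedSpace ℂ E]
    (f : A ⊗[ℂ] B →ₗ[ℂ] E) (hf : ∀ z, ‖f z‖ ≤ minNorm z) : AlgTensor A B →L[ℂ] E :=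
  LinearMap.mkContinuous
    { toFun := fun z : AlgTensor A B => f z
      map_add' := f.map_add
      map_smul' := f.map_smul } 1
    (fun z => (hf z).trans (one_mul (minNorm (A := A) (B := B) z)).ge)

/-- Continuous extension to the minimal tensor product of a linear map which is contractive for
the minimal norm. -/
noncomputable def MinTensor.extend {E : Type*} [NormedAddCommGroup E] [NormedSpace ℂ E]
    [CompleteSpace E] (f : A ⊗[ℂ] B →ₗ[ℂ] E) (hf : ∀ z, ‖f z‖ ≤ minNorm z) :
    MinTensor A B →L[ℂ] E :=
  (AlgTensor.mkCLM f hf).fromCompletion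

theorem MinTensor.extend_incl {E : Type*} [NormedAddCommGroup E] [NormedSpace ℂ E]
    [CompleteSpace E] (f : A ⊗[ℂ] B →ₗ[ℂ] E) (hf : ∀ z, ‖f z‖ ≤ minNorm z) (z : A ⊗[ℂ] B) :
    MinTensor.extend f hf (MinTensor.incl A B z) = f z :=
  ContinuousLinearMap.fromCompletion_apply_coe (AlgTensor.mkCLM f hf) z

end MinTensor

/-- A state of a unital C*-algebra: a positive linear functional with value `1` at the unit. -/
structure State (A : Type u) [CStarAlgebra A] [PartialOrder A] [StarOrderedRing A]
    extends A →ₚ[ℂ] ℂ where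
  map_one' : toFun 1 = 1

/-- A unital completely positive map. -/
structure UCPMap (A : Type u) [CStarAlgebra A] [PartialOrder A] [StarOrderedRing A]
    extends CompletelyPositiveMap A A where
  map_one' : toFun 1 = 1

section Basic

variable {A : Type u} [CStarAlgebra A] [PartialOrder A] [StarOrderedRing A]

noncomputable instance : CoeFun (State A) fun _ => A → ℂ := ⟨fun φ => φ.toPositiveLinearMap⟩

noncomputable instance : CoeFun (UCPMap A) fun _ => A → A := ⟨fun T => T.toCompletelyPositiveMap⟩

theorem State.apply_one (φ : State A) : φ 1 = 1 := φ.map_one'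

theorem UCPMap.apply_one (T : UCPMap A) : T 1 = 1 := T.map_one'

/-- The GNS representation of a positive functional. -/
noncomputable def gnsRep (f : A →ₚ[ℂ] ℂ) : HilbertRep A where
  space := f.GNS
  rep := f.gnsStarAlgHom

/-- The vector of the GNS space given by an element of the algebra. -/
noncomputable def gnsVec (f : A →ₚ[ℂ] ℂ) (x : A) : (gnsRep f).space :=
  ((f.toPreGNS x : f.PreGNS) : f.GNS)

theorem inner_gnsVec (f : A →ₚ[ℂ] ℂ) (x y a : A) :
    ⟪gnsVec f x, (gnsRep f).rep a (gnsVec f y)⟫_ℂ = f (star x * (a * y)) := by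
  have h : (gnsRep f).rep a (gnsVec f y) = gnsVec f (a * y) :=
    f.gnsNonUnitalStarAlgHom_apply_coe (a := a) (b := f.toPreGNS y)
  rw [h]
  exact (Completion.inner_coe (E := f.PreGNS) _ _).trans (f.preGNS_inner_def _ _)

end Basic

section Tensor

variable {A : Type u} {B : Type v} [CStarAlgebra A] [CStarAlgebra B]

theorem HilbertRep.inner_tensor_tmul (π : HilbertRep A) (σ : HilbertRep B) (a : A) (b : B)
    (h h' : π.space) (k k' : σ.space) :
    ⟪HilbertTensor.incl π.space σ.space (h ⊗ₜ k),
      π.tensor σ (a ⊗ₜ b) (HilbertTensor.incl π.space σ.space (h' ⊗ₜ k'))⟫_ℂ =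
    ⟪h, π.rep a h'⟫_ℂ * ⟪k, σ.rep b k'⟫_ℂ := by
  rw [HilbertRep.tensor_tmul, HilbertTensor.map_incl, LinearIsometry.inner_map_map,
    TensorProduct.mapL_tmul, TensorProduct.inner_tmul]

variable [PartialOrder A] [StarOrderedRing A] [PartialOrder B] [StarOrderedRing B]

/-- The functional `x ⊗ y ↦ φ(x) ψ(y)` on the algebraic tensor product. -/
noncomputable def State.algTensor (φ : State A) (ψ : State B) : A ⊗[ℂ] B →ₗ[ℂ] ℂ :=
  TensorProduct.lift ((LinearMap.mul ℂ ℂ).compl₁₂ φ.toLinearMap ψ.toLinearMap)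

theorem State.algTensor_tmul (φ : State A) (ψ : State B) (a : A) (b : B) :
    φ.algTensor ψ (a ⊗ₜ b) = φ a * ψ b := rfl

theorem State.algTensor_eq (φ : State A) (ψ : State B) :
    ∃ (π : HilbertRep A) (σ : HilbertRep B) (ξ : HilbertTensor π.space σ.space), ‖ξ‖ = 1 ∧
      ∀ z, φ.algTensor ψ z = ⟪ξ, π.tensor σ z ξ⟫_ℂ := by
  let f := φ.toPositiveLinearMap
  let g := ψ.toPositiveLinearMap
  let ξ := HilbertTensor.incl (gnsRep f).space (gnsRep g).space (gnsVec f 1 ⊗ₜ gnsVec g 1)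
  have key : ∀ z, φ.algTensor ψ z = ⟪ξ, (gnsRep f).tensor (gnsRep g) z ξ⟫_ℂ := by
    intro z
    induction z with
    | zero => rw [map_zero, map_zero, zero_apply, inner_zero_right]
    | add x y hx hy => rw [map_add, map_add, add_apply, inner_add_right, hx, hy]
    | tmul a b =>
      rw [HilbertRep.inner_tensor_tmul, inner_gnsVec, inner_gnsVec, State.algTensor_tmul]
      simp only [star_one, one_mul, mul_one]
      rfl
  refine ⟨gnsRep f, gnsRep g, ξ, ?_, key⟩
  have h1 := key 1
  rw [map_one ((gnsRep f).tensor (gnsRep g)), one_apply_eq_self, Algebra.TensorProduct.one_def,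
    State.algTensor_tmul, State.apply_one, State.apply_one, mul_one, inner_self_eq_norm_sq_to_K] at h1
  have h2 : ‖ξ‖ ^ 2 = 1 := Complex.ofReal_injective (by
    rw [Complex.ofReal_pow, Complex.ofReal_one]
    exact h1.symm)
  exact (pow_eq_one_iff_of_nonneg (norm_nonneg ξ) two_ne_zero).mp h2

theorem State.norm_algTensor_le (φ : State A) (ψ : State B) (z : A ⊗[ℂ] B) :
    ‖φ.algTensor ψ z‖ ≤ minNorm z := by
  obtain ⟨π, σ, ξ, hξ, h⟩ := φ.algTensor_eq ψ
  rw [h]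
  calc ‖⟪ξ, π.tensor σ z ξ⟫_ℂ‖ ≤ ‖ξ‖ * ‖π.tensor σ z ξ‖ := norm_inner_le_norm _ _
    _ ≤ ‖ξ‖ * (‖π.tensor σ z‖ * ‖ξ‖) := by gcongr; exact ContinuousLinearMap.le_opNorm _ _
    _ = ‖π.tensor σ z‖ := by rw [hξ, one_mul, mul_one]
    _ ≤ minNorm z := norm_tensor_le_minNorm π σ z

theorem State.algTensor_nonneg (φ : State A) (ψ : State B) (z : A ⊗[ℂ] B) :
    0 ≤ φ.algTensor ψ (star z * z) := by
  obtain ⟨π, σ, ξ, hξ, h⟩ := φ.algTensor_eq ψ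
  rw [h, map_mul, map_star, mul_apply_eq_comp, ContinuousLinearMap.star_eq_adjoint,
    ContinuousLinearMap.adjoint_inner_right, inner_self_eq_norm_sq_to_K]
  positivity

/-- The product state `φ ⊗ ψ` on the minimal tensor product. -/
noncomputable def State.tensor (φ : State A) (ψ : State B) : State (MinTensor A B) where
  toPositiveLinearMap := PositiveLinearMap.mk₀
    (MinTensor.extend (φ.algTensor ψ) (φ.norm_algTensor_le ψ)).toLinearMap
    (fun x hx => by
      obtain ⟨y, rfl⟩ := CStarAlgebra.nonneg_iff_eq_star_mul_self.mp hx
      rw [ContinuousLinearMap.coe_coe]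
      clear hx
      induction y using (MinTensor.denseRange_incl A B).induction_on with
      | hp =>
        exact isClosed_le continuous_const
          ((MinTensor.extend (φ.algTensor ψ) (φ.norm_algTensor_le ψ)).continuous.comp (continuous_star.mul continuous_id))
      | ih y =>
        rw [← map_star, ← map_mul, MinTensor.extend_incl]
        exact φ.algTensor_nonneg ψ y)
  map_one' := by
    change MinTensor.extend (φ.algTensor ψ) (φ.norm_algTensor_le ψ) 1 = 1
    rw [← map_one (MinTensor.incl A B), MinTensor.extend_incl, Algebra.TensorProduct.one_def,
      State.algTensor_tmul, State.apply_one, State.apply_one, mul_one]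

theorem State.tensor_tmul (φ : State A) (ψ : State B) (a : A) (b : B) :
    φ.tensor ψ (MinTensor.tmul a b) = φ a * ψ b :=
  MinTensor.extend_incl (φ.algTensor ψ) (φ.norm_algTensor_le ψ) (a ⊗ₜ b)

end Tensor

section Dilation

variable {A : Type u} [CStarAlgebra A] [PartialOrder A] [StarOrderedRing A]

theorem exists_eq_star_mul_self {C : Type*} [NonUnitalCStarAlgebra C] [PartialOrder C]
    [StarOrderedRing C] {x : C} (hx : 0 ≤ x) : ∃ y, x = star y * y :=
  CStarAlgebra.nonneg_iff_eq_star_mul_self.mp hx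

theorem matrix_sum_apply {A : Type u} [CStarAlgebra A] {ι κ : Type} (s : Finset κ) (M : κ → CStarMatrix ι ι A) (i j : ι) :
    (∑ r ∈ s, M r) i j = ∑ r ∈ s, M r i j := by
  classical
  induction s using Finset.induction_on with
  | empty => rfl
  | insert r s hr ih => rw [Finset.sum_insert hr, Finset.sum_insert hr, ← ih]; rfl

theorem rankOne_nonneg {ι : Type} [Fintype ι] [DecidableEq ι] (a : ι → A) :
    0 ≤ (CStarMatrix.ofMatrix fun i j => star (a i) * a j : CStarMatrix ι ι A) := by
  rcases isEmpty_or_nonempty ι with hι | ⟨⟨i₀⟩⟩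
  · exact (CStarMatrix.ext fun i => isEmptyElim i : (0 : CStarMatrix ι ι A) = _).le
  let N : CStarMatrix ι ι A := CStarMatrix.ofMatrix fun γ j => if γ = i₀ then a j else 0
  have h : (CStarMatrix.ofMatrix fun i j => star (a i) * a j : CStarMatrix ι ι A) = star N * N := by
    ext i j
    rw [CStarMatrix.mul_apply, Finset.sum_eq_single i₀]
    · rw [CStarMatrix.star_apply]
      change _ = star (if i₀ = i₀ then a i else 0) * (if i₀ = i₀ then a j else 0)
      rw [if_pos rfl, if_pos rfl]
      rfl
    · intro γ _ hγ
      change _ * (if γ = i₀ then a j else 0) = 0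
      rw [if_neg hγ, mul_zero]
    · exact fun h => absurd (Finset.mem_univ _) h
  rw [h]
  exact star_mul_self_nonneg N

theorem UCPMap.exists_factor (T : UCPMap A) {ι : Type} [Fintype ι] [DecidableEq ι] (a : ι → A) :
    ∃ y : ι → ι → A, ∀ i j, T (star (a i) * a j) = ∑ γ, star (y γ i) * y γ j := by
  have h := T.toCompletelyPositiveMap.map_cstarMatrix_nonneg _ (rankOne_nonneg a)
  obtain ⟨N, hN⟩ := exists_eq_star_mul_self h
  refine ⟨fun γ i => N γ i, fun i j => ?_⟩
  have h2 := congrArg (fun M : CStarMatrix ι ι A => M i j) hN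
  exact h2.trans (CStarMatrix.mul_apply)

/-- The positive functional `M ↦ ∑ ⟨h i, π(T(M i j)) h j⟩` on matrices. -/
noncomputable def dilationFunctional (T : UCPMap A) (π : HilbertRep A) {ι : Type} [Fintype ι]
    [DecidableEq ι] (h : ι → π.space) : CStarMatrix ι ι A →ₚ[ℂ] ℂ :=
  PositiveLinearMap.mk₀
    { toFun := fun M => ∑ i, ∑ j, ⟪h i, π.rep (T (M i j)) (h j)⟫_ℂ
      map_add' := fun M N => by
        simp only [CStarMatrix.add_apply, map_add, add_apply, inner_add_right,
          Finset.sum_add_distrib]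
      map_smul' := fun c M => by
        simp only [CStarMatrix.smul_apply, map_smul, smul_apply, inner_smul_right,
          Finset.mul_sum, RingHom.id_apply, smul_eq_mul] }
    (fun M hM => by
      obtain ⟨N, hN⟩ := exists_eq_star_mul_self
        (T.toCompletelyPositiveMap.map_cstarMatrix_nonneg M hM)
      have hN' : ∀ i j, T (M i j) = ∑ γ, star (N γ i) * N γ j := fun i j => by
        have h2 := congrArg (fun M : CStarMatrix ι ι A => M i j) hN
        exact h2.trans CStarMatrix.mul_apply
      have key : ∑ i, ∑ j, ⟪h i, π.rep (T (M i j)) (h j)⟫_ℂ =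
          ∑ γ, ⟪∑ i, π.rep (N γ i) (h i), ∑ j, π.rep (N γ j) (h j)⟫_ℂ := by
        simp only [hN', map_sum, sum_apply, inner_sum, sum_inner, map_mul,
          map_star, mul_apply_eq_comp, ContinuousLinearMap.star_eq_adjoint,
          ContinuousLinearMap.adjoint_inner_right]
        rw [Finset.sum_comm_cycle]
        exact Finset.sum_congr rfl fun γ _ => Finset.sum_comm
      change 0 ≤ ∑ i, ∑ j, ⟪h i, π.rep (T (M i j)) (h j)⟫_ℂ
      rw [key]
      refine Finset.sum_nonneg fun γ _ => ?_
      rw [inner_self_eq_norm_sq_to_K]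
      positivity)

theorem exists_dilation (T : UCPMap A) (π : HilbertRep A) {ι : Type} [Fintype ι]
    [DecidableEq ι] (h : ι → π.space) :
    ∃ (ρ : HilbertRep A) (v : ι → ρ.space), ∀ a i j,
      ⟪v i, ρ.rep a (v j)⟫_ℂ = ⟪h i, π.rep (T a) (h j)⟫_ℂ := by
  rcases isEmpty_or_nonempty ι with hι | ⟨⟨i₀⟩⟩
  · exact ⟨π, h, fun a i => isEmptyElim i⟩
  let F := dilationFunctional T π h
  let D : A →⋆ₐ[ℂ] CStarMatrix ι ι A :=
    { toFun := fun a => CStarMatrix.ofMatrix (Matrix.diagonal fun _ => a)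
      map_one' := rfl
      map_mul' := fun a b => (Matrix.diagonal_mul_diagonal (fun _ => a) (fun _ => b)).symm
      map_zero' := Matrix.diagonal_zero
      map_add' := fun a b => (Matrix.diagonal_add (fun _ => a) (fun _ => b)).symm
      commutes' := fun c => rfl
      map_star' := fun a => (Matrix.diagonal_conjTranspose (fun _ : ι => a)).symm }
  let e : ι → CStarMatrix ι ι A := fun i => CStarMatrix.ofMatrix (Matrix.single i₀ i 1)
  refine ⟨{ space := (gnsRep F).space, rep := (gnsRep F).rep.comp D }, fun i => gnsVec F (e i),
    fun a i j => ?_⟩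
  refine (inner_gnsVec F (e i) (e j) (D a)).trans ?_
  have hM : star (e i) * (D a * e j) = CStarMatrix.ofMatrix (Matrix.single i j a) := by
    have hm : (Matrix.single i₀ i (1 : A)).conjTranspose *
        ((Matrix.diagonal fun _ : ι => a) * Matrix.single i₀ j (1 : A)) = Matrix.single i j a := by
      have hd : (Matrix.diagonal fun _ : ι => a) * Matrix.single i₀ j (1 : A) =
          Matrix.single i₀ j a := by
        ext k l
        rw [Matrix.diagonal_mul]
        simp [Matrix.single]
      rw [hd, Matrix.conjTranspose_single, star_one, Matrix.single_mul_single_same, one_mul]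
    exact hm
  rw [hM]
  change ∑ i', ∑ j', ⟪h i', π.rep (T (Matrix.single i j a i' j')) (h j')⟫_ℂ = _
  rw [Finset.sum_eq_single i, Finset.sum_eq_single j]
  · simp
  · intro j' _ hj
    simp [Matrix.single, hj.symm]
  · simp
  · intro i' _ hi
    simp [Matrix.single, hi.symm]
  · simp

end Dilation

section TensorMap

variable {A : Type u} {B : Type v} [CStarAlgebra A] [CStarAlgebra B]

theorem exists_fin_sum_tmul {M : Type*} {N : Type*} [AddCommGroup M] [Module ℂ M]
    [AddCommGroup N] [Module ℂ N] (x : M ⊗[ℂ] N) :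
    ∃ (n : ℕ) (h : Fin n → M) (k : Fin n → N), x = ∑ i, h i ⊗ₜ[ℂ] k i := by
  obtain ⟨S, rfl⟩ := TensorProduct.exists_finset x
  refine ⟨S.card, fun i => (S.equivFin.symm i).1.1, fun i => (S.equivFin.symm i).1.2, ?_⟩
  rw [← Finset.sum_coe_sort S]
  exact (Equiv.sum_comp S.equivFin.symm fun p : S => p.1.1 ⊗ₜ[ℂ] p.1.2).symm

theorem norm_eq_of_inner_self_eq {E F : Type*} [NormedAddCommGroup E] [InnerProductSpace ℂ E]
    [NormedAddCommGroup F] [InnerProductSpace ℂ F] {x : E} {y : F} (h : ⟪x, x⟫_ℂ = ⟪y, y⟫_ℂ) :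
    ‖x‖ = ‖y‖ := by
  rw [norm_eq_sqrt_re_inner (𝕜 := ℂ) x, norm_eq_sqrt_re_inner (𝕜 := ℂ) y, h]

variable [PartialOrder A] [StarOrderedRing A] [PartialOrder B] [StarOrderedRing B]

/-- The map `x ⊗ y ↦ T(x) ⊗ S(y)` on the algebraic tensor product. -/
noncomputable def UCPMap.algTensor (T : UCPMap A) (S : UCPMap B) : A ⊗[ℂ] B →ₗ[ℂ] A ⊗[ℂ] B :=
  TensorProduct.map T.toLinearMap S.toLinearMap

theorem UCPMap.algTensor_tmul (T : UCPMap A) (S : UCPMap B) (a : A) (b : B) :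
    T.algTensor S (a ⊗ₜ b) = T a ⊗ₜ S b := rfl

theorem UCPMap.algTensor_one (T : UCPMap A) (S : UCPMap B) : T.algTensor S 1 = 1 := by
  rw [Algebra.TensorProduct.one_def, UCPMap.algTensor_tmul, T.apply_one, S.apply_one]

theorem UCPMap.norm_inner_algTensor_le (T : UCPMap A) (S : UCPMap B) (z : A ⊗[ℂ] B)
    (π : HilbertRep A) (σ : HilbertRep B) (x y : π.space ⊗[ℂ] σ.space) :
    ‖⟪HilbertTensor.incl π.space σ.space x,
      π.tensor σ (T.algTensor S z) (HilbertTensor.incl π.space σ.space y)⟫_ℂ‖ ≤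
    minNorm z * ‖x‖ * ‖y‖ := by
  obtain ⟨n, h₁, k₁, rfl⟩ := exists_fin_sum_tmul x
  obtain ⟨m, h₂, k₂, rfl⟩ := exists_fin_sum_tmul y
  obtain ⟨ρ, v, hv⟩ := exists_dilation T π (Sum.elim h₁ h₂)
  obtain ⟨τ, w, hw⟩ := exists_dilation S σ (Sum.elim k₁ k₂)
  let I := HilbertTensor.incl π.space σ.space
  let J := HilbertTensor.incl ρ.space τ.space
  have key : ∀ (z : A ⊗[ℂ] B) (i j : Fin n ⊕ Fin m),
      ⟪J (v i ⊗ₜ w i), ρ.tensor τ z (J (v j ⊗ₜ w j))⟫_ℂ =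
      ⟪I (Sum.elim h₁ h₂ i ⊗ₜ Sum.elim k₁ k₂ i),
        π.tensor σ (T.algTensor S z) (I (Sum.elim h₁ h₂ j ⊗ₜ Sum.elim k₁ k₂ j))⟫_ℂ := by
    intro z i j
    induction z with
    | zero => simp only [map_zero, zero_apply, inner_zero_right]
    | add a b ha hb => simp only [map_add, add_apply, inner_add_right, ha, hb]
    | tmul a b =>
      rw [UCPMap.algTensor_tmul, HilbertRep.inner_tensor_tmul, HilbertRep.inner_tensor_tmul,
        hv, hw]
  have keyOne : ∀ i j : Fin n ⊕ Fin m, ⟪J (v i ⊗ₜ w i), J (v j ⊗ₜ w j)⟫_ℂ =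
      ⟪I (Sum.elim h₁ h₂ i ⊗ₜ Sum.elim k₁ k₂ i),
        I (Sum.elim h₁ h₂ j ⊗ₜ Sum.elim k₁ k₂ j)⟫_ℂ := by
    intro i j
    have h1 := key 1 i j
    rwa [T.algTensor_one, map_one, map_one, one_apply_eq_self, one_apply_eq_self] at h1
  have norm₁ : ‖∑ i, J (v (Sum.inl i) ⊗ₜ w (Sum.inl i))‖ = ‖∑ i, h₁ i ⊗ₜ[ℂ] k₁ i‖ := by
    rw [← I.norm_map, map_sum]
    refine norm_eq_of_inner_self_eq ?_
    simp only [sum_inner, inner_sum, keyOne, Sum.elim_inl]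
  have norm₂ : ‖∑ i, J (v (Sum.inr i) ⊗ₜ w (Sum.inr i))‖ = ‖∑ i, h₂ i ⊗ₜ[ℂ] k₂ i‖ := by
    rw [← I.norm_map, map_sum]
    refine norm_eq_of_inner_self_eq ?_
    simp only [sum_inner, inner_sum, keyOne, Sum.elim_inr]
  have eq : ⟪I (∑ i, h₁ i ⊗ₜ[ℂ] k₁ i), π.tensor σ (T.algTensor S z)
      (I (∑ i, h₂ i ⊗ₜ[ℂ] k₂ i))⟫_ℂ = ⟪∑ i, J (v (Sum.inl i) ⊗ₜ w (Sum.inl i)),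
        ρ.tensor τ z (∑ i, J (v (Sum.inr i) ⊗ₜ w (Sum.inr i)))⟫_ℂ := by
    simp only [map_sum, sum_inner, inner_sum, key, Sum.elim_inl, Sum.elim_inr]
  refine (congrArg norm eq).trans_le ?_
  refine (norm_inner_le_norm _ _).trans ?_
  rw [norm₁, mul_comm (minNorm z), mul_assoc]
  refine mul_le_mul_of_nonneg_left ?_ (norm_nonneg _)
  refine (ContinuousLinearMap.le_opNorm _ _).trans ?_
  rw [norm₂]
  exact mul_le_mul_of_nonneg_right (norm_tensor_le_minNorm ρ τ z) (norm_nonneg _)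

theorem UCPMap.minNorm_algTensor_le (T : UCPMap A) (S : UCPMap B) (z : A ⊗[ℂ] B) :
    minNorm (T.algTensor S z) ≤ minNorm z := by
  refine minNorm_le (minNorm_nonneg z) fun π σ => ?_
  refine HilbertTensor.opNorm_le (minNorm_nonneg z) fun y => ?_
  set η := π.tensor σ (T.algTensor S z) (HilbertTensor.incl π.space σ.space y) with hη
  have h : ∀ ζ : HilbertTensor π.space σ.space, ‖⟪ζ, η⟫_ℂ‖ ≤ minNorm z * ‖ζ‖ * ‖y‖ := by
    intro ζ
    induction ζ using (HilbertTensor.denseRange_incl π.space σ.space).induction_on with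
    | hp => exact isClosed_le (by fun_prop) (by fun_prop)
    | ih x =>
      rw [LinearIsometry.norm_map]
      exact T.norm_inner_algTensor_le S z π σ x y
  have h2 := h η
  rw [inner_self_eq_norm_sq_to_K, norm_pow, RCLike.norm_ofReal, abs_norm, sq] at h2
  rcases (norm_nonneg η).eq_or_lt with h0 | h0
  · rw [← h0]
    exact mul_nonneg (minNorm_nonneg z) (norm_nonneg y)
  · exact le_of_mul_le_mul_right (h2.trans_eq (by ring)) h0

/-- The continuous extension of `x ⊗ y ↦ T(x) ⊗ S(y)` to the minimal tensor product. -/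
noncomputable def UCPMap.tensorL (T : UCPMap A) (S : UCPMap B) :
    MinTensor A B →L[ℂ] MinTensor A B :=
  MinTensor.extend ((MinTensor.incl A B).toAlgHom.toLinearMap ∘ₗ T.algTensor S) fun z =>
    (MinTensor.norm_incl (T.algTensor S z)).trans_le (T.minNorm_algTensor_le S z)

theorem UCPMap.tensorL_incl (T : UCPMap A) (S : UCPMap B) (z : A ⊗[ℂ] B) :
    T.tensorL S (MinTensor.incl A B z) = MinTensor.incl A B (T.algTensor S z) :=
  MinTensor.extend_incl _ _ z

theorem UCPMap.exists_algTensor_factor (T : UCPMap A) (S : UCPMap B) {n : ℕ}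
    (w : Fin n → A ⊗[ℂ] B) : ∃ (κ : Type) (_ : Fintype κ) (y : κ → Fin n → A ⊗[ℂ] B),
      ∀ i j, T.algTensor S (star (w i) * w j) = ∑ r, star (y r i) * y r j := by
  choose m a b hw using fun i => exists_fin_sum_tmul (w i)
  obtain ⟨c, hc⟩ := T.exists_factor (fun p : Σ i, Fin (m i) => a p.1 p.2)
  obtain ⟨d, hd⟩ := S.exists_factor (fun p : Σ i, Fin (m i) => b p.1 p.2)
  refine ⟨(Σ i, Fin (m i)) × Σ i, Fin (m i), inferInstance,
    fun r i => ∑ p, c r.1 ⟨i, p⟩ ⊗ₜ[ℂ] d r.2 ⟨i, p⟩, fun i j => ?_⟩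
  have h : ∀ p q, T.algTensor S (star (a i p ⊗ₜ[ℂ] b i p) * (a j q ⊗ₜ[ℂ] b j q)) =
      ∑ r : (Σ i, Fin (m i)) × Σ i, Fin (m i),
        star (c r.1 ⟨i, p⟩ ⊗ₜ[ℂ] d r.2 ⟨i, p⟩) * (c r.1 ⟨j, q⟩ ⊗ₜ[ℂ] d r.2 ⟨j, q⟩) := by
    intro p q
    rw [TensorProduct.star_tmul, Algebra.TensorProduct.tmul_mul_tmul, UCPMap.algTensor_tmul,
      hc ⟨i, p⟩ ⟨j, q⟩, hd ⟨i, p⟩ ⟨j, q⟩, TensorProduct.sum_tmul, Fintype.sum_prod_type]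
    simp only [TensorProduct.tmul_sum, TensorProduct.star_tmul,
      Algebra.TensorProduct.tmul_mul_tmul]
  rw [hw i, hw j]
  simp only [star_sum, Finset.sum_mul_sum, map_sum, h]
  exact Finset.sum_comm_cycle

/-- The tensor product `T ⊗ S` of two unital completely positive maps, acting on the minimal
tensor product; it is determined by `(T ⊗ S)(x ⊗ y) = T(x) ⊗ S(y)`. -/
noncomputable def UCPMap.tensor (T : UCPMap A) (S : UCPMap B) : UCPMap (MinTensor A B) where
  toLinearMap := (T.tensorL S).toLinearMap
  map_cstarMatrix_nonneg' := by
    intro n M hM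
    obtain ⟨N, hN⟩ := exists_eq_star_mul_self hM
    have key : ∀ c : Fin n → MinTensor A B,
        0 ≤ (CStarMatrix.ofMatrix fun i j => T.tensorL S (star (c i) * c j) :
          CStarMatrix (Fin n) (Fin n) (MinTensor A B)) := by
      intro c
      have hd : DenseRange fun w : Fin n → A ⊗[ℂ] B => fun i => MinTensor.incl A B (w i) :=
        DenseRange.piMap fun _ => MinTensor.denseRange_incl A B
      induction c using hd.induction_on with
      | hp =>
        refine (CStarAlgebra.isClosed_nonneg
          (A := CStarMatrix (Fin n) (Fin n) (MinTensor A B))).preimage ?_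
        refine continuous_pi fun i => continuous_pi fun j => ?_
        exact (T.tensorL S).continuous.comp
          ((continuous_star.comp (continuous_apply i)).mul (continuous_apply j))
      | ih w =>
        obtain ⟨κ, _, y, hy⟩ := T.exists_algTensor_factor S w
        have h : (CStarMatrix.ofMatrix fun i j => T.tensorL S
            (star (MinTensor.incl A B (w i)) * MinTensor.incl A B (w j)) :
              CStarMatrix (Fin n) (Fin n) (MinTensor A B)) =
            ∑ r, CStarMatrix.ofMatrix fun i j =>
              star (MinTensor.incl A B (y r i)) * MinTensor.incl A B (y r j) := by
          ext i j
          rw [matrix_sum_apply]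
          change T.tensorL S (star (MinTensor.incl A B (w i)) * MinTensor.incl A B (w j)) =
            ∑ r, star (MinTensor.incl A B (y r i)) * MinTensor.incl A B (y r j)
          rw [← map_star, ← map_mul, UCPMap.tensorL_incl, hy, map_sum]
          simp only [map_mul, map_star]
        rw [h]
        exact Finset.sum_nonneg fun r _ => rankOne_nonneg _
    have h : M.map (T.tensorL S).toLinearMap = ∑ γ, (CStarMatrix.ofMatrix fun i j =>
        T.tensorL S (star (N γ i) * N γ j) : CStarMatrix (Fin n) (Fin n) (MinTensor A B)) := by
      ext i j
      rw [matrix_sum_apply, hN]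
      change T.tensorL S ((star N * N) i j) = ∑ γ, T.tensorL S (star (N γ i) * N γ j)
      rw [CStarMatrix.mul_apply, map_sum]
      rfl
    rw [h]
    exact Finset.sum_nonneg fun γ _ => key fun i => N γ i
  map_one' := by
    change T.tensorL S 1 = 1
    rw [← map_one (MinTensor.incl A B), UCPMap.tensorL_incl, T.algTensor_one]

theorem UCPMap.tensor_tmul (T : UCPMap A) (S : UCPMap B) (a : A) (b : B) :
    T.tensor S (MinTensor.tmul a b) = MinTensor.tmul (T a) (S b) :=
  T.tensorL_incl S (a ⊗ₜ b)

end TensorMap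

section Ergodic

variable {A : Type u} [CStarAlgebra A] [PartialOrder A] [StarOrderedRing A]

/-- The state `φ` is invariant under `T`, i.e. `(A, φ, T)` is a state preserving C*-dynamical
system. -/
def IsStatePreserving (φ : State A) (T : UCPMap A) : Prop :=
  ∀ x, φ (T x) = φ x

/-- The state preserving system `(A, φ, T)` is uniquely ergodic: `φ` is the unique invariant state
of `T`. -/
def IsUniquelyErgodic (φ : State A) (T : UCPMap A) : Prop :=
  IsStatePreserving φ T ∧ ∀ ψ : State A, IsStatePreserving ψ T → ψ = φ

/-- The state preserving system `(A, φ, T)` is strictly weak mixing: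
`(1/n) ∑_{k<n} |ψ(T^k x) - ψ(1) φ(x)| → 0` for all `x ∈ A` and all `ψ` in the dual space. -/
def IsStrictlyWeakMixing (φ : State A) (T : UCPMap A) : Prop :=
  IsStatePreserving φ T ∧ ∀ (x : A) (ψ : StrongDual ℂ A),
    Tendsto (fun n : ℕ => (1 / (n : ℝ)) *
      ∑ k ∈ Finset.range n, ‖ψ ((fun y => T y)^[k] x) - ψ 1 * φ x‖) atTop (𝓝 0)

/-- The condition `A* ⊗ B* = (A ⊗ B)*`: the finite sums of product functionals `ψ ⊗ χ`, with `ψ`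
and `χ` bounded functionals on `A` and `B`, are norm dense in the dual of the minimal tensor
product. Here `ψ ⊗ χ` is the bounded functional with values `ψ(a) χ(b)` at the elementary
tensors `a ⊗ b`. -/
def DualTensorEq (A : Type u) (B : Type v) [CStarAlgebra A] [CStarAlgebra B] : Prop :=
  (Submodule.span ℂ {ω : StrongDual ℂ (MinTensor A B) |
    ∃ (ψ : StrongDual ℂ A) (χ : StrongDual ℂ B),
      ∀ a b, ω (MinTensor.tmul a b) = ψ a * χ b}).topologicalClosure = ⊤

end Ergodic

end CStarDyn

open CStarDyn

/-! Write `A_n` for the Cesàro averages of the iterates of a unital completely positive map.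

The engine is that unique ergodicity makes `ω(A_n x)` converge to `φ(x)` uniformly over all states
`ω` (`IsUniquelyErgodic.eventually_norm_sub_lt`). Otherwise a limit of the states `ω_n ∘ A_n` along
an ultrafilter would be a second invariant state, because `A_n(T x) - A_n(x)` telescopes to `0`. As
states control the norm up to a factor `2`, `A_n x` then converges in norm to `φ(x) 1`.

(i) ⇒ (ii). Tensoring with the one dimensional algebra shows that `T` is uniquely ergodic, so (i)
applies to the system itself and `T ⊗ T` is uniquely ergodic. With `y = x - φ(x) 1`, the averages of
`y ⊗ y*` evaluated at `ω ⊗ ω` are the averages of `|ω(T^k y)|²`; these tend to `0` uniformly in `ω`,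
and by Cauchy–Schwarz so do the averages of `|ω(T^k y)|`. Uniformity permits the passage from states
to bounded functionals without decomposing the latter: phases `c_k` turn `∑ |ψ(T^k y)|` into `ψ(∑
c_k T^k y)`, and the norm of that sum is controlled by states (`sum_norm_apply_le`).

(ii) ⇒ (iii). On a product functional, `ψ(T^k a) χ(H^k b)` splits into `(ψ(T^k a) - ψ(1) φ(a)) χ(H^k
b)`, whose averages vanish by weak mixing, and `ψ(1) φ(a) χ(H^k b)`, whose averages converge by
unique ergodicity of `H`. The functionals for which the averages of `a ⊗ b` have the expected limit
form a closed subspace, hence the whole dual. An invariant state is constant along the averages, so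
it equals its limit, the product state. -/

namespace CStarDyn

/-! ### States: existence, norm control and compactness -/

section States

variable {A : Type u} [CStarAlgebra A] [PartialOrder A] [StarOrderedRing A]

theorem State.ext {φ ψ : State A} (h : ∀ x, φ x = ψ x) : φ = ψ := by
  cases φ
  cases ψ
  congr
  exact PositiveLinearMap.ext h

/-- In the GNS representation `φ` is the vector state of a unit vector, and representations are
contractive. -/
theorem State.norm_apply_le (φ : State A) (x : A) : ‖φ x‖ ≤ ‖x‖ := by
  let f := φ.toPositiveLinearMap
  have key : ∀ a, φ a = ⟪gnsVec f 1, (gnsRep f).rep a (gnsVec f 1)⟫_ℂ := fun a => by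
    rw [inner_gnsVec, star_one, one_mul, mul_one]
  have h1 : ‖gnsVec f 1‖ * ‖gnsVec f 1‖ = 1 := by
    have h := key 1
    rw [map_one (gnsRep f).rep, one_apply_eq_self, φ.apply_one, inner_self_eq_norm_sq_to_K] at h
    rw [← sq]
    exact Complex.ofReal_injective (by
      rw [Complex.ofReal_pow, Complex.ofReal_one]
      exact h.symm)
  calc ‖φ x‖ ≤ ‖gnsVec f 1‖ * ‖(gnsRep f).rep x (gnsVec f 1)‖ := by
        rw [key]; exact norm_inner_le_norm _ _
    _ ≤ ‖gnsVec f 1‖ * (‖x‖ * ‖gnsVec f 1‖) := by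
        gcongr
        exact (ContinuousLinearMap.le_opNorm _ _).trans
          (mul_le_mul_of_nonneg_right (NonUnitalStarAlgHom.norm_apply_le _ x) (norm_nonneg _))
    _ = ‖x‖ := by rw [mul_left_comm, h1, mul_one]

/-- A state, as a bounded functional. -/
noncomputable def State.toCLM (φ : State A) : StrongDual ℂ A :=
  φ.toLinearMap.mkContinuous 1 fun x => (φ.norm_apply_le x).trans_eq (one_mul _).symm

/-- A real functional that is nonnegative on the positive cone and takes the value `1` at the unit,
as a state. -/
noncomputable def State.ofReal (f : A →ₗ[ℝ] ℝ) (hf : ∀ x, 0 ≤ x → 0 ≤ f x) (h1 : f 1 = 1) :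
    State A where
  toPositiveLinearMap := PositiveLinearMap.mk₀
    (Module.Dual.extendRCLike (𝕜 := ℂ)
      (f ∘ₗ (selfAdjoint.submodule ℝ A).subtype ∘ₗ realPart (A := A)))
    -- The complex extension of a real functional `g` is `g(x) - i g(i x)`. Here `g` is `f` applied
    -- to the real part, and the real part of `i x` is minus the imaginary part of `x`, which
    -- vanishes for self-adjoint `x`.
    (fun x hx => by
      have hs : IsSelfAdjoint x := .of_nonneg hx
      rw [Module.Dual.extendRCLike_apply]
      change 0 ≤ ((f (realPart x : A) : ℝ) : ℂ) - Complex.I *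
        ((f (realPart (Complex.I • x) : A) : ℝ) : ℂ)
      rw [realPart_I_smul, hs.imaginaryPart, hs.coe_realPart]
      simpa using hf x hx)
  map_one' := by
    have hs : IsSelfAdjoint (1 : A) := .one A
    change Module.Dual.extendRCLike (𝕜 := ℂ)
      (f ∘ₗ (selfAdjoint.submodule ℝ A).subtype ∘ₗ realPart (A := A)) 1 = 1
    rw [Module.Dual.extendRCLike_apply]
    change ((f (realPart (1 : A) : A) : ℝ) : ℂ) - Complex.I *
      ((f (realPart (Complex.I • (1 : A)) : A) : ℝ) : ℂ) = 1
    rw [realPart_I_smul, hs.imaginaryPart, hs.coe_realPart, h1]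
    simp

theorem State.re_ofReal_apply (f : A →ₗ[ℝ] ℝ) (hf : ∀ x, 0 ≤ x → 0 ≤ f x) (h1 : f 1 = 1)
    {x : A} (hx : IsSelfAdjoint x) : (State.ofReal f hf h1 x).re = f x := by
  refine (Module.Dual.re_extendRCLike_apply (𝕜 := ℂ)
    (f ∘ₗ (selfAdjoint.submodule ℝ A).subtype ∘ₗ realPart (A := A)) x).trans ?_
  change f (realPart x : A) = f x
  rw [hx.coe_realPart]

/-- The closed cone of nonnegative elements. -/
def positiveCone (A : Type u) [CStarAlgebra A] [PartialOrder A] [StarOrderedRing A] :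
    ProperCone ℝ A where
  carrier := {a | 0 ≤ a}
  add_mem' ha hb := add_nonneg ha hb
  zero_mem' := le_refl _
  smul_mem' c _ hx := smul_nonneg c.2 hx
  isClosed' := CStarAlgebra.isClosed_nonneg

/-- Hahn–Banach: a hyperplane separates `x` from the closed positive cone, and the separating
functional, normalized at `1`, is a state. -/
theorem exists_state_re_neg {x : A} (hx : IsSelfAdjoint x) (h : ¬ 0 ≤ x) :
    ∃ ω : State A, (ω x).re < 0 := by
  obtain ⟨f, hf, hfx⟩ := (positiveCone A).hyperplane_separation_point (x₀ := x) h
  replace hf : ∀ a, 0 ≤ a → 0 ≤ f a := hf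
  -- If `f 1` were `0`, positivity of `x + ‖x‖ 1` would give `0 ≤ f x`, contrary to the separation.
  have h1 : 0 < f 1 := by
    refine (hf 1 zero_le_one).lt_of_ne fun h0 => ?_
    have h2 := hf _ (neg_le_iff_add_nonneg.mp hx.neg_algebraMap_norm_le_self)
    rw [Algebra.algebraMap_eq_smul_one, map_add, map_smul, ← h0, smul_zero, add_zero] at h2
    exact h2.not_gt hfx
  refine ⟨State.ofReal ((f 1)⁻¹ • f.toLinearMap)
    (fun a ha => mul_nonneg (inv_nonneg.mpr h1.le) (hf a ha)) (inv_mul_cancel₀ h1.ne'), ?_⟩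
  rw [State.re_ofReal_apply _ _ _ hx]
  exact mul_neg_of_pos_of_neg (inv_pos.mpr h1) hfx

theorem State.apply_star (ω : State A) (x : A) : ω (star x) = star (ω x) :=
  map_star ω.toPositiveLinearMap x

theorem State.apply_algebraMap (ω : State A) (c : ℝ) : ω (algebraMap ℝ A c) = c := by
  rw [Algebra.algebraMap_eq_smul_one, ← Complex.coe_smul, map_smul, ω.apply_one, smul_eq_mul,
    mul_one]

theorem le_algebraMap_of_forall_state {x : A} (hx : IsSelfAdjoint x) {C : ℝ}
    (h : ∀ ω : State A, ‖ω x‖ ≤ C) : x ≤ algebraMap ℝ A C := by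
  by_contra hn
  rw [← sub_nonneg] at hn
  obtain ⟨ω, hω⟩ := exists_state_re_neg ((IsSelfAdjoint.algebraMap A (.all C)).sub hx) hn
  rw [map_sub, ω.apply_algebraMap, Complex.sub_re, Complex.ofReal_re] at hω
  linarith [(Complex.re_le_norm (ω x)).trans (h ω)]

theorem IsSelfAdjoint.norm_le_of_forall_state {x : A} (hx : IsSelfAdjoint x) {C : ℝ} (hC : 0 ≤ C)
    (h : ∀ ω : State A, ‖ω x‖ ≤ C) : ‖x‖ ≤ C := by
  rcases subsingleton_or_nontrivial A with hA | hA
  · rwa [Subsingleton.elim x 0, norm_zero]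
  have h1 := (le_algebraMap_iff_spectrum_le hx).mp (le_algebraMap_of_forall_state hx h)
  have h2 := (le_algebraMap_iff_spectrum_le hx.neg).mp (le_algebraMap_of_forall_state hx.neg
    (C := C) fun ω => by rw [map_neg, norm_neg]; exact h ω)
  -- For self-adjoint `x`, `‖x‖` or `-‖x‖` is a spectral value, so the order bounds on `x` and `-x`
  -- bound the norm.
  rcases CStarAlgebra.norm_or_neg_norm_mem_spectrum hx with hs | hs
  · exact h1 _ hs
  · refine h2 _ ?_
    rw [← spectrum.neg_eq]
    exact hs

/-- The factor `2` comes from treating real and imaginary parts separately; this crude bound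
suffices throughout. -/
theorem norm_le_of_forall_state {x : A} {C : ℝ} (hC : 0 ≤ C) (h : ∀ ω : State A, ‖ω x‖ ≤ C) :
    ‖x‖ ≤ 2 * C := by
  -- `c = 1` gives the real part of `x`, and `c = I` gives minus its imaginary part.
  have key : ∀ c : ℂ, ‖c‖ = 1 → ‖(2⁻¹ : ℝ) • (c • x + star (c • x))‖ ≤ C := fun c hc => by
    refine IsSelfAdjoint.norm_le_of_forall_state
      ((IsSelfAdjoint.all (2⁻¹ : ℝ)).smul (IsSelfAdjoint.add_star_self _)) hC fun ω => ?_
    rw [← Complex.coe_smul, map_smul, map_add, ω.apply_star, norm_smul, map_smul]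
    have h1 : ‖c • ω x‖ ≤ C := by rw [norm_smul, hc, one_mul]; exact h ω
    calc ‖((2⁻¹ : ℝ) : ℂ)‖ * ‖c • ω x + star (c • ω x)‖
        ≤ ‖((2⁻¹ : ℝ) : ℂ)‖ * (C + C) := by
          gcongr
          exact norm_add_le_of_le h1 ((norm_star _).trans_le h1)
      _ = C := by rw [Complex.norm_real, Real.norm_of_nonneg (by norm_num)]; ring
  have h1 := key 1 norm_one
  have h2 := key Complex.I Complex.norm_I
  have hx : x = (2⁻¹ : ℝ) • ((1 : ℂ) • x + star ((1 : ℂ) • x)) +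
      (-Complex.I) • (2⁻¹ : ℝ) • (Complex.I • x + star (Complex.I • x)) := by
    have hI : star Complex.I = -Complex.I := Complex.conj_I
    have hm : -Complex.I * (((2⁻¹ : ℝ) : ℂ) * Complex.I) = ((2⁻¹ : ℝ) : ℂ) := by
      rw [mul_left_comm, neg_mul, Complex.I_mul_I, neg_neg, mul_one]
    have h2 : ((2⁻¹ : ℝ) : ℂ) + ((2⁻¹ : ℝ) : ℂ) = 1 := by push_cast; norm_num
    simp only [← Complex.coe_smul, smul_add, smul_smul, star_smul, one_smul, hI]
    rw [hm, mul_neg, mul_neg, hm, neg_smul, add_add_add_comm, add_neg_cancel,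
      add_zero, ← add_smul, h2, one_smul]
  rw [hx]
  refine (norm_add_le _ _).trans ?_
  rw [norm_smul (-Complex.I), norm_neg, Complex.norm_I, one_mul]
  linarith

/-- Pointwise ultrafilter limits of positive contractive functionals are states. -/
theorem exists_state_tendsto {ι : Type*} (U : Ultrafilter ι) (f : ι → A →ₗ[ℂ] ℂ)
    (hb : ∀ i x, ‖f i x‖ ≤ ‖x‖) (hp : ∀ i x, 0 ≤ x → 0 ≤ f i x)
    (h1 : Tendsto (fun i => f i 1) U (𝓝 1)) :
    ∃ ψ : State A, ∀ x, Tendsto (fun i => f i x) U (𝓝 (ψ x)) := by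
  have hlim : ∀ x, ∃ c, Tendsto (fun i => f i x) U (𝓝 c) := fun x => by
    obtain ⟨c, -, hc⟩ := (isCompact_closedBall (0 : ℂ) ‖x‖).ultrafilter_le_nhds
      (U.map fun i => f i x) (le_principal_iff.mpr (mem_map.mpr
        (univ_mem' fun i => mem_closedBall_zero_iff.mpr (hb i x))))
    exact ⟨c, hc⟩
  choose g hg using hlim
  let G : A →ₗ[ℂ] ℂ :=
    { toFun := g
      map_add' := fun x y => tendsto_nhds_unique (hg _) (by
        simpa only [map_add] using (hg x).add (hg y))
      map_smul' := fun c x => tendsto_nhds_unique (hg _) (by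
        simpa only [map_smul, RingHom.id_apply] using (hg x).const_smul c) }
  exact ⟨{ toPositiveLinearMap := PositiveLinearMap.mk₀ G fun x hx =>
            ge_of_tendsto' (hg x) fun i => hp i x hx
           map_one' := tendsto_nhds_unique (hg 1) h1 }, hg⟩

end States

/-! ### Iterates, Cesàro averages and uniform convergence -/

section Averages

variable {A : Type u} [CStarAlgebra A] [PartialOrder A] [StarOrderedRing A]

theorem UCPMap.apply_nonneg (T : UCPMap A) {x : A} (hx : 0 ≤ x) : 0 ≤ T x :=
  map_nonneg T.toCompletelyPositiveMap hx

/-- The state `ω ∘ T`. -/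
noncomputable def State.comp (ω : State A) (T : UCPMap A) : State A where
  toPositiveLinearMap := PositiveLinearMap.mk₀ (ω.toLinearMap ∘ₗ T.toLinearMap)
    fun _ hx => map_nonneg ω.toPositiveLinearMap (T.apply_nonneg hx)
  map_one' := (congrArg ω T.apply_one).trans ω.apply_one

/-- The iterates of a unital completely positive map. -/
noncomputable def UCPMap.iter (T : UCPMap A) (k : ℕ) : A →ₗ[ℂ] A := T.toLinearMap ^ k

theorem UCPMap.iter_apply (T : UCPMap A) (k : ℕ) (x : A) :
    T.iter k x = (fun y => T y)^[k] x :=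
  Module.End.pow_apply T.toLinearMap k x

theorem UCPMap.iter_succ_apply (T : UCPMap A) (k : ℕ) (x : A) :
    T.iter (k + 1) x = T.iter k (T x) := by
  rw [iter_apply, iter_apply, Function.iterate_succ_apply]

theorem UCPMap.iter_one (T : UCPMap A) (k : ℕ) : T.iter k 1 = 1 := by
  rw [iter_apply]
  exact Function.iterate_fixed T.apply_one k

/-- Any bound valid for all states thereby transfers to the iterates, without proving that the
iterates are completely positive. -/
theorem State.exists_comp_iter (ω : State A) (T : UCPMap A) (k : ℕ) :
    ∃ ω' : State A, ∀ x, ω (T.iter k x) = ω' x := by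
  induction k with
  | zero => exact ⟨ω, fun x => rfl⟩
  | succ k ih =>
    obtain ⟨ω', h⟩ := ih
    exact ⟨ω'.comp T, fun x => by rw [T.iter_succ_apply, h]; rfl⟩

theorem UCPMap.norm_iter_le (T : UCPMap A) (k : ℕ) (x : A) : ‖T.iter k x‖ ≤ 2 * ‖x‖ := by
  refine norm_le_of_forall_state (norm_nonneg x) fun ω => ?_
  obtain ⟨ω', h⟩ := ω.exists_comp_iter T k
  rw [h]
  exact ω'.norm_apply_le x

theorem IsStatePreserving.apply_iter {φ : State A} {T : UCPMap A} (h : IsStatePreserving φ T)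
    (k : ℕ) (x : A) : φ (T.iter k x) = φ x := by
  induction k generalizing x with
  | zero => rfl
  | succ k ih => rw [T.iter_succ_apply, ih, h]

/-- The Cesàro averages of a unital completely positive map. -/
noncomputable def UCPMap.avg (T : UCPMap A) (n : ℕ) : A →ₗ[ℂ] A :=
  (n : ℂ)⁻¹ • ∑ k ∈ Finset.range n, T.iter k

theorem UCPMap.avg_apply (T : UCPMap A) (n : ℕ) (x : A) :
    T.avg n x = (n : ℂ)⁻¹ • ∑ k ∈ Finset.range n, T.iter k x := by
  rw [UCPMap.avg, LinearMap.smul_apply, LinearMap.sum_apply]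

/-- The average `A_0` is zero, since the inverse of `0` is `0`; hence the condition on `n`. -/
theorem UCPMap.avg_one (T : UCPMap A) {n : ℕ} (hn : n ≠ 0) : T.avg n 1 = 1 := by
  simp only [T.avg_apply, T.iter_one, Finset.sum_const, Finset.card_range]
  rw [← Nat.cast_smul_eq_nsmul ℂ, smul_smul, inv_mul_cancel₀ (Nat.cast_ne_zero.mpr hn), one_smul]

theorem UCPMap.apply_avg {F : Type*} [FunLike F A ℂ] [LinearMapClass F ℂ A ℂ] (T : UCPMap A)
    (ψ : F) (n : ℕ) (x : A) :
    ψ (T.avg n x) = (n : ℂ)⁻¹ * ∑ k ∈ Finset.range n, ψ (T.iter k x) := by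
  rw [T.avg_apply, map_smul, map_sum, smul_eq_mul]

theorem norm_inv_mul_sum_le {E : Type*} [SeminormedAddCommGroup E] [NormedSpace ℂ E] (n : ℕ)
    {f : ℕ → E} {C : ℝ} (hC : 0 ≤ C) (h : ∀ k, ‖f k‖ ≤ C) :
    ‖(n : ℂ)⁻¹ • ∑ k ∈ Finset.range n, f k‖ ≤ C := by
  rw [norm_smul, norm_inv, Complex.norm_natCast]
  rcases n.eq_zero_or_pos with rfl | hn
  · simpa using hC
  rw [inv_mul_le_iff₀ (Nat.cast_pos.mpr hn)]
  refine (norm_sum_le_of_le _ fun k _ => h k).trans_eq ?_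
  rw [Finset.sum_const, Finset.card_range, nsmul_eq_mul]

theorem State.norm_apply_avg_le (ω : State A) (T : UCPMap A) (n : ℕ) (x : A) :
    ‖ω (T.avg n x)‖ ≤ ‖x‖ := by
  rw [T.apply_avg]
  refine norm_inv_mul_sum_le n (norm_nonneg x) fun k => ?_
  obtain ⟨ω', h⟩ := ω.exists_comp_iter T k
  rw [h]
  exact ω'.norm_apply_le x

theorem UCPMap.norm_avg_le (T : UCPMap A) (n : ℕ) (x : A) : ‖T.avg n x‖ ≤ 2 * ‖x‖ :=
  norm_le_of_forall_state (norm_nonneg x) fun ω => ω.norm_apply_avg_le T n x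

theorem State.apply_avg_nonneg (ω : State A) (T : UCPMap A) (n : ℕ) {x : A} (hx : 0 ≤ x) :
    0 ≤ ω (T.avg n x) := by
  rw [T.apply_avg]
  refine mul_nonneg (inv_nonneg.mpr (Nat.cast_nonneg n)) (Finset.sum_nonneg fun k _ => ?_)
  obtain ⟨ω', h⟩ := ω.exists_comp_iter T k
  rw [h]
  exact map_nonneg ω'.toPositiveLinearMap hx

/-- The sums telescope; this is what makes limits of averages invariant. -/
theorem UCPMap.avg_map_sub (T : UCPMap A) (n : ℕ) (x : A) :
    T.avg n (T x) - T.avg n x = (n : ℂ)⁻¹ • (T.iter n x - x) := by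
  rw [T.avg_apply, T.avg_apply, ← smul_sub, ← Finset.sum_sub_distrib]
  simp only [← T.iter_succ_apply]
  rw [Finset.sum_range_sub fun k => T.iter k x]
  rfl

theorem UCPMap.tendsto_avg_map_sub (T : UCPMap A) (x : A) :
    Tendsto (fun n => T.avg n (T x) - T.avg n x) atTop (𝓝 0) := by
  simp only [T.avg_map_sub]
  refine squeeze_zero_norm (a := fun n : ℕ => (n : ℝ)⁻¹ * (3 * ‖x‖)) (fun n => ?_) ?_
  · rw [norm_smul, norm_inv, Complex.norm_natCast]
    gcongr
    exact (norm_sub_le _ _).trans (by linarith [T.norm_iter_le n x])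
  · simpa using (tendsto_inv_atTop_nhds_zero_nat (𝕜 := ℝ)).mul_const (3 * ‖x‖)

/-- For a uniquely ergodic system the averages `ω(A_n(x))` converge to `φ(x)` uniformly in the
state `ω`. -/
theorem IsUniquelyErgodic.eventually_norm_sub_lt {φ : State A} {T : UCPMap A}
    (h : IsUniquelyErgodic φ T) (x : A) {ε : ℝ} (hε : 0 < ε) :
    ∀ᶠ n in atTop, ∀ ω : State A, ‖ω (T.avg n x) - φ x‖ < ε := by
  by_contra hcon
  rw [not_eventually, frequently_iff_neBot] at hcon
  have hex : ∀ n, ∃ ω : State A, ¬ (∀ ω : State A, ‖ω (T.avg n x) - φ x‖ < ε) →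
      ε ≤ ‖ω (T.avg n x) - φ x‖ := fun n => by
    by_cases hn : ∀ ω : State A, ‖ω (T.avg n x) - φ x‖ < ε
    · exact ⟨φ, fun h => absurd hn h⟩
    · obtain ⟨ω, hω⟩ := not_forall.mp hn
      exact ⟨ω, fun _ => not_lt.mp hω⟩
  choose ω hω using hex
  let U := Ultrafilter.of
    (atTop ⊓ 𝓟 {n | ¬ ∀ ω : State A, ‖ω (T.avg n x) - φ x‖ < ε})
  have hU := Ultrafilter.of_le (atTop ⊓ 𝓟 {n | ¬ ∀ ω : State A, ‖ω (T.avg n x) - φ x‖ < ε})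
  have hU1 : (U : Filter ℕ) ≤ atTop := hU.trans inf_le_left
  have hU2 : ∀ᶠ n in (U : Filter ℕ), ¬ ∀ ω : State A, ‖ω (T.avg n x) - φ x‖ < ε :=
    le_principal_iff.mp (hU.trans inf_le_right)
  obtain ⟨ψ, hψ⟩ := exists_state_tendsto U (fun n => (ω n).toLinearMap ∘ₗ T.avg n)
    (fun n y => (ω n).norm_apply_avg_le T n y) (fun n y hy => (ω n).apply_avg_nonneg T n hy)
    (tendsto_const_nhds.congr' (((eventually_ne_atTop 0).filter_mono hU1).mono fun n hn => by
      change 1 = ω n (T.avg n 1)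
      rw [T.avg_one hn, State.apply_one]))
  replace hψ : ∀ y, Tendsto (fun n => ω n (T.avg n y)) U (𝓝 (ψ y)) := hψ
  -- Invariance survives in the limit because `A_n(T y) - A_n(y)` tends to `0` in norm and states
  -- are contractive.
  have hinv : IsStatePreserving ψ T := fun y => by
    refine sub_eq_zero.mp (tendsto_nhds_unique ((hψ (T y)).sub (hψ y)) ?_)
    refine squeeze_zero_norm (fun n => ?_)
      ((tendsto_zero_iff_norm_tendsto_zero.mp (T.tendsto_avg_map_sub y)).mono_left hU1)
    rw [← map_sub]
    exact (ω n).norm_apply_le _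
  have hlim := tendsto_iff_norm_sub_tendsto_zero.mp (h.2 ψ hinv ▸ hψ x)
  obtain ⟨n, hn1, hn2⟩ := (hU2.and (hlim.eventually_lt_const hε)).exists
  exact (hω n hn1).not_gt hn2

theorem IsUniquelyErgodic.tendsto_apply_avg {φ : State A} {T : UCPMap A}
    (h : IsUniquelyErgodic φ T) (χ : StrongDual ℂ A) (x : A) :
    Tendsto (fun n => χ (T.avg n x)) atTop (𝓝 (χ 1 * φ x)) := by
  have key : Tendsto (fun n => T.avg n x) atTop (𝓝 (φ x • (1 : A))) := by
    refine Metric.tendsto_atTop'.mpr fun ε hε => ?_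
    -- States lose a factor `2` in the norm, so `ε / 4` gives `ε / 2 < ε`.
    obtain ⟨N, hN⟩ := eventually_atTop.mp (h.eventually_norm_sub_lt x (by positivity : 0 < ε / 4))
    refine ⟨N, fun n hn => ?_⟩
    rw [dist_eq_norm]
    refine (norm_le_of_forall_state (C := ε / 4) (by positivity) fun ω => ?_).trans_lt
      (by linarith)
    rw [map_sub, map_smul, ω.apply_one, smul_eq_mul, mul_one]
    exact (hN n hn.le ω).le
  have h2 := (χ.continuous.tendsto _).comp key
  rwa [map_smul, smul_eq_mul, mul_comm] at h2

end Averages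

/-! ### The one dimensional system -/

section Trivial

/-- The identity, as a unital completely positive map. -/
noncomputable def UCPMap.id (A : Type u) [CStarAlgebra A] [PartialOrder A] [StarOrderedRing A] :
    UCPMap A where
  toLinearMap := LinearMap.id
  map_cstarMatrix_nonneg' _ _ hM := hM
  map_one' := rfl

/-- The unique state of the one dimensional C*-algebra. -/
noncomputable def evalState : State (PUnit.{u + 1} → ℂ) where
  toPositiveLinearMap := PositiveLinearMap.mk₀ (LinearMap.proj PUnit.unit) fun _ hx => hx _
  map_one' := rfl

theorem isUniquelyErgodic_evalState :
    IsUniquelyErgodic evalState.{u} (UCPMap.id (PUnit.{u + 1} → ℂ)) := by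
  refine ⟨fun x => rfl, fun ψ _ => State.ext fun x => ?_⟩
  have hx : x = x PUnit.unit • (1 : PUnit.{u + 1} → ℂ) := by
    ext
    simp
  rw [hx, map_smul, map_smul, ψ.apply_one, evalState.apply_one]

end Trivial

/-! ### Determination by elementary tensors -/

section Density

variable {A : Type u} {B : Type v} [CStarAlgebra A] [CStarAlgebra B]

theorem MinTensor.one_eq_tmul : (1 : MinTensor A B) = MinTensor.tmul 1 1 :=
  (map_one (MinTensor.incl A B)).symm

theorem MinTensor.clm_ext {E : Type*} [TopologicalSpace E] [T2Space E] [AddCommMonoid E]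
    [Module ℂ E] {f g : MinTensor A B →L[ℂ] E}
    (h : ∀ a b, f (MinTensor.tmul a b) = g (MinTensor.tmul a b)) (x : MinTensor A B) :
    f x = g x := by
  refine congrFun ((MinTensor.denseRange_incl A B).equalizer f.continuous g.continuous
    (funext fun z => ?_)) x
  change f (MinTensor.incl A B z) = g (MinTensor.incl A B z)
  induction z with
  | zero => rw [map_zero, map_zero, map_zero]
  | add y z hy hz => rw [map_add, map_add, map_add, hy, hz]
  | tmul a b => exact h a b

theorem State.ext_tmul {φ ψ : State (MinTensor A B)}
    (h : ∀ a b, φ (MinTensor.tmul a b) = ψ (MinTensor.tmul a b)) : φ = ψ :=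
  State.ext (MinTensor.clm_ext (f := φ.toCLM) (g := ψ.toCLM) h)

end Density

/-! ### Product systems -/

section Products

variable {A : Type u} {B : Type v} [CStarAlgebra A] [PartialOrder A] [StarOrderedRing A]
  [CStarAlgebra B] [PartialOrder B] [StarOrderedRing B]

theorem IsStatePreserving.tensor {φ : State A} {T : UCPMap A} {φ₁ : State B} {H : UCPMap B}
    (h : IsStatePreserving φ T) (h₁ : IsStatePreserving φ₁ H) :
    IsStatePreserving (φ.tensor φ₁) (T.tensor H) := by
  have key : (φ.tensor φ₁).comp (T.tensor H) = φ.tensor φ₁ := State.ext_tmul fun a b => by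
    change φ.tensor φ₁ (T.tensor H (MinTensor.tmul a b)) = _
    rw [UCPMap.tensor_tmul, State.tensor_tmul, State.tensor_tmul, h, h₁]
  exact fun x => congrArg (fun ω : State (MinTensor A B) => ω x) key

theorem UCPMap.iter_tensor_tmul (T : UCPMap A) (H : UCPMap B) (k : ℕ) (a : A) (b : B) :
    (T.tensor H).iter k (MinTensor.tmul a b) = MinTensor.tmul (T.iter k a) (H.iter k b) := by
  induction k generalizing a b with
  | zero => rfl
  | succ k ih => simp only [UCPMap.iter_succ_apply, UCPMap.tensor_tmul, ih]

/-- An invariant `ψ` yields the invariant product `ψ ⊗ φ₁`, from which `ψ` is recovered on the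
elements `x ⊗ 1`. -/
theorem IsUniquelyErgodic.of_tensor {φ : State A} {T : UCPMap A} {φ₁ : State B} {H : UCPMap B}
    (hT : IsStatePreserving φ T) (h₁ : IsStatePreserving φ₁ H)
    (h : IsUniquelyErgodic (φ.tensor φ₁) (T.tensor H)) : IsUniquelyErgodic φ T := by
  refine ⟨hT, fun ψ hψ => State.ext fun x => ?_⟩
  have h2 := congrArg (fun ω : State (MinTensor A B) => ω (MinTensor.tmul x 1))
    (h.2 (ψ.tensor φ₁) (hψ.tensor h₁))
  simpa only [State.tensor_tmul, State.apply_one, mul_one] using h2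

end Products

/-! ### From the tensor square to strict weak mixing -/

section Mixing

variable {A : Type u} [CStarAlgebra A] [PartialOrder A] [StarOrderedRing A]

/-- At `z = 0` the quotient is `0`, so the phase only satisfies `‖c‖ ≤ 1`. -/
theorem exists_norm_le_one_mul_eq_norm (z : ℂ) : ∃ c : ℂ, ‖c‖ ≤ 1 ∧ c * z = ‖z‖ := by
  refine ⟨star z / ‖z‖, ?_, ?_⟩
  · rw [norm_div, norm_star, Complex.norm_real, norm_norm]
    exact div_self_le_one _
  · rcases eq_or_ne z 0 with rfl | hz
    · simp
    · have hz' : (‖z‖ : ℂ) ≠ 0 := Complex.ofReal_ne_zero.mpr (norm_ne_zero_iff.mpr hz)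
      rw [div_mul_eq_mul_div, div_eq_iff hz', mul_comm]
      exact (Complex.mul_conj' z).trans (sq _)

/-- A bound on sums of absolute values that holds for all states holds, up to a constant, for all
bounded functionals. -/
theorem sum_norm_apply_le {ι : Type*} (s : Finset ι) (y : ι → A) {C : ℝ} (hC : 0 ≤ C)
    (h : ∀ ω : State A, ∑ k ∈ s, ‖ω (y k)‖ ≤ C) (ψ : StrongDual ℂ A) :
    ∑ k ∈ s, ‖ψ (y k)‖ ≤ ‖ψ‖ * (2 * C) := by
  choose c hc hcz using fun k => exists_norm_le_one_mul_eq_norm (ψ (y k))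
  have h1 : ((∑ k ∈ s, ‖ψ (y k)‖ : ℝ) : ℂ) = ψ (∑ k ∈ s, c k • y k) := by
    simp only [Complex.ofReal_sum, map_sum, map_smul, smul_eq_mul, hcz]
  have h2 : ‖∑ k ∈ s, c k • y k‖ ≤ 2 * C := norm_le_of_forall_state hC fun ω => by
    rw [map_sum]
    refine (norm_sum_le_of_le s fun k _ => ?_).trans (h ω)
    rw [map_smul, norm_smul]
    exact mul_le_of_le_one_left (norm_nonneg _) (hc k)
  calc ∑ k ∈ s, ‖ψ (y k)‖ = ‖ψ (∑ k ∈ s, c k • y k)‖ := by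
        rw [← h1, Complex.norm_real, Real.norm_of_nonneg (Finset.sum_nonneg fun _ _ => norm_nonneg _)]
    _ ≤ ‖ψ‖ * ‖∑ k ∈ s, c k • y k‖ := ψ.le_opNorm _
    _ ≤ ‖ψ‖ * (2 * C) := by gcongr

/-- `ω ∘ T^k` is again a state, hence Hermitian, so its values at `x` and `star x` multiply to a
squared modulus. -/
theorem State.tensor_avg_tmul_star (ω : State A) (T : UCPMap A) (n : ℕ) (x : A) :
    ω.tensor ω ((T.tensor T).avg n (MinTensor.tmul x (star x))) =
      (((n : ℝ)⁻¹ * ∑ k ∈ Finset.range n, ‖ω (T.iter k x)‖ ^ 2 : ℝ) : ℂ) := by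
  rw [UCPMap.apply_avg]
  push_cast
  congr 1
  refine Finset.sum_congr rfl fun k _ => ?_
  obtain ⟨ω', h⟩ := ω.exists_comp_iter T k
  rw [UCPMap.iter_tensor_tmul, State.tensor_tmul, h, h, ω'.apply_star]
  exact Complex.mul_conj' _

/-- If the tensor square of a system is uniquely ergodic, the system is strictly weak mixing. -/
theorem IsUniquelyErgodic.isStrictlyWeakMixing {φ : State A} {T : UCPMap A}
    (hT : IsStatePreserving φ T) (h : IsUniquelyErgodic (φ.tensor φ) (T.tensor T)) :
    IsStrictlyWeakMixing φ T := by
  refine ⟨hT, fun x ψ => ?_⟩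
  let y := x - φ x • (1 : A)
  have hy : φ y = 0 := by
    rw [map_sub, map_smul, φ.apply_one, smul_eq_mul, mul_one, sub_self]
  have hψ : ∀ k, ψ ((fun y => T y)^[k] x) - ψ 1 * φ x = ψ (T.iter k y) := fun k => by
    rw [← T.iter_apply, map_sub, map_smul, T.iter_one, map_sub, map_smul, smul_eq_mul, mul_comm]
  simp only [hψ]
  refine Metric.tendsto_atTop'.mpr fun ε hε => ?_
  -- The final estimate is `2 ‖ψ‖ δ`; the added `1` makes it strictly less than `ε` and covers `ψ =
  -- 0`.
  set δ := ε / (2 * ‖ψ‖ + 1) with hδ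
  have hδ0 : 0 < δ := by positivity
  obtain ⟨N, hN⟩ := eventually_atTop.mp
    (h.eventually_norm_sub_lt (MinTensor.tmul y (star y)) (pow_pos hδ0 2))
  refine ⟨N, fun n hn => ?_⟩
  have hn0 : (0 : ℝ) < n := Nat.cast_pos.mpr (Nat.zero_lt_of_lt hn)
  have hbound : ∀ ω : State A, ∑ k ∈ Finset.range n, ‖ω (T.iter k y)‖ ≤ n * δ := fun ω => by
    have h1 := hN n hn.le (ω.tensor ω)
    rw [State.tensor_avg_tmul_star, State.tensor_tmul, hy, zero_mul, sub_zero, Complex.norm_real,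
      Real.norm_of_nonneg (mul_nonneg (inv_nonneg.mpr hn0.le)
        (Finset.sum_nonneg fun _ _ => sq_nonneg _)), inv_mul_lt_iff₀ hn0] at h1
    -- Cauchy–Schwarz: the squared sum is at most `n` times the sum of squares, which is below `n
    -- δ²`.
    refine abs_le_of_sq_le_sq' ?_ (by positivity) |>.2
    refine sq_sum_le_card_mul_sum_sq.trans ?_
    rw [Finset.card_range, mul_pow, sq (n : ℝ), mul_assoc]
    gcongr
  have h2 := sum_norm_apply_le (Finset.range n) (fun k => T.iter k y) (by positivity) hbound ψ
  rw [dist_zero_right, Real.norm_of_nonneg (mul_nonneg (by positivity)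
    (Finset.sum_nonneg fun _ _ => norm_nonneg _)), one_div, inv_mul_lt_iff₀ hn0]
  refine h2.trans_lt ?_
  have h3 : 2 * ‖ψ‖ * δ < ε := by
    have : (2 * ‖ψ‖ + 1) * δ = ε := mul_div_cancel₀ _ (by positivity)
    linarith
  calc ‖ψ‖ * (2 * (n * δ)) = n * (2 * ‖ψ‖ * δ) := by ring
    _ < n * ε := by gcongr

end Mixing

/-! ### From strict weak mixing to unique ergodicity of products -/

section Converse

variable {A : Type u} {B : Type v} [CStarAlgebra A] [PartialOrder A] [StarOrderedRing A]
  [CStarAlgebra B] [PartialOrder B] [StarOrderedRing B]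

theorem tendsto_apply_avg_tmul_of_product {φ : State A} {T : UCPMap A} {φ₁ : State B}
    {H : UCPMap B} (hT : IsStrictlyWeakMixing φ T) (hH : IsUniquelyErgodic φ₁ H)
    {ω : StrongDual ℂ (MinTensor A B)} {ψ : StrongDual ℂ A} {χ : StrongDual ℂ B}
    (hω : ∀ a b, ω (MinTensor.tmul a b) = ψ a * χ b) (a : A) (b : B) :
    Tendsto (fun n => ω ((T.tensor H).avg n (MinTensor.tmul a b))) atTop
      (𝓝 (ω 1 * (φ a * φ₁ b))) := by
  have h1 := (hH.tendsto_apply_avg χ b).const_mul (ψ 1 * φ a)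
  have h2 : Tendsto (fun n : ℕ => (n : ℂ)⁻¹ * ∑ k ∈ Finset.range n,
      (ψ (T.iter k a) - ψ 1 * φ a) * χ (H.iter k b)) atTop (𝓝 0) := by
    -- The factors `χ(H^k b)` are bounded by `‖χ‖ (2 ‖b‖)`, leaving the average that weak mixing
    -- controls.
    refine squeeze_zero_norm (fun n => ?_)
      (by simpa using (hT.2 a ψ).mul_const (‖χ‖ * (2 * ‖b‖)))
    rw [norm_mul, norm_inv, Complex.norm_natCast, mul_assoc, Finset.sum_mul]
    gcongr
    refine norm_sum_le_of_le _ fun k _ => ?_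
    rw [norm_mul, ← T.iter_apply]
    gcongr
    exact (χ.le_opNorm _).trans (mul_le_mul_of_nonneg_left (H.norm_iter_le k b) (norm_nonneg _))
  have h3 := h2.add h1
  rw [MinTensor.one_eq_tmul, hω]
  convert h3 using 2 with n
  · rw [UCPMap.apply_avg, UCPMap.apply_avg, mul_left_comm, ← mul_add]
    rw [Finset.mul_sum (Finset.range n) _ (ψ 1 * φ a), ← Finset.sum_add_distrib]
    refine congrArg _ (Finset.sum_congr rfl fun k _ => ?_)
    rw [UCPMap.iter_tensor_tmul, hω]
    ring
  · ring

/-- As the sequence is bounded, replacing `ω` by a functional close in norm changes `ω(z n) - ω(e)`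
little, uniformly in `n`. -/
theorem isClosed_setOf_tendsto_apply {E : Type*} [SeminormedAddCommGroup E] [NormedSpace ℂ E]
    {z : ℕ → E} {C : ℝ} (hC : ∀ n, ‖z n‖ ≤ C) (e : E) :
    IsClosed {ω : StrongDual ℂ E | Tendsto (fun n => ω (z n)) atTop (𝓝 (ω e))} := by
  have hC0 : 0 ≤ C := (norm_nonneg _).trans (hC 0)
  refine isClosed_of_closure_subset fun ω hω => Metric.tendsto_atTop'.mpr fun ε hε => ?_
  have hD : 0 < C + ‖e‖ + 1 := by positivity
  obtain ⟨η, hη, hlt⟩ := Metric.mem_closure_iff.mp hω (ε / (2 * (C + ‖e‖ + 1))) (by positivity)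
  obtain ⟨N, hN⟩ := Metric.tendsto_atTop'.mp hη (ε / 2) (half_pos hε)
  refine ⟨N, fun n hn => ?_⟩
  have h1 : ‖(ω - η) (z n - e)‖ ≤ ‖ω - η‖ * (C + ‖e‖ + 1) :=
    (ContinuousLinearMap.le_opNorm _ _).trans (mul_le_mul_of_nonneg_left
      ((norm_sub_le _ _).trans (by linarith [hC n])) (norm_nonneg _))
  have h2 : ‖ω - η‖ * (C + ‖e‖ + 1) < ε / 2 := by
    rw [dist_eq_norm, ← div_div, lt_div_iff₀ hD] at hlt
    exact hlt
  have h3 := hN n hn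
  rw [dist_eq_norm] at h3 ⊢
  have h4 : ω (z n) - ω e = (ω - η) (z n - e) + (η (z n) - η e) := by
    rw [sub_apply, map_sub, map_sub]
    ring
  rw [h4]
  refine (norm_add_le _ _).trans_lt ?_
  linarith

/-- The limit is written as the value of `ω` at a fixed element, so that the condition on `ω` is
linear and closed. -/
theorem tendsto_apply_avg_tmul {φ : State A} {T : UCPMap A} {φ₁ : State B}
    {H : UCPMap B} (hT : IsStrictlyWeakMixing φ T) (hH : IsUniquelyErgodic φ₁ H)
    (hAB : DualTensorEq A B) (ω : StrongDual ℂ (MinTensor A B)) (a : A) (b : B) :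
    Tendsto (fun n => ω ((T.tensor H).avg n (MinTensor.tmul a b))) atTop
      (𝓝 (ω ((φ a * φ₁ b) • 1))) := by
  have hmem : ω ∈ (⊤ : Submodule ℂ (StrongDual ℂ (MinTensor A B))) := trivial
  rw [← hAB, ← SetLike.mem_coe, Submodule.topologicalClosure_coe] at hmem
  refine closure_minimal (t := {ω | Tendsto (fun n => ω ((T.tensor H).avg n
    (MinTensor.tmul a b))) atTop (𝓝 (ω ((φ a * φ₁ b) • 1)))}) (fun ω' hω' => ?_)
    (isClosed_setOf_tendsto_apply (fun n => (T.tensor H).norm_avg_le n _) _) hmem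
  refine Submodule.span_induction (fun η hη => ?_) ?_ (fun η θ _ _ hη hθ => ?_)
    (fun c η _ hη => ?_) hω'
  · obtain ⟨ψ, χ, h⟩ := hη
    change Tendsto _ _ _
    rw [map_smul, smul_eq_mul, mul_comm]
    exact tendsto_apply_avg_tmul_of_product hT hH h a b
  · exact tendsto_const_nhds
  · exact hη.add hθ
  · exact hη.const_smul c

theorem IsStrictlyWeakMixing.isUniquelyErgodic_tensor {φ : State A} {T : UCPMap A} {φ₁ : State B}
    {H : UCPMap B} (hT : IsStrictlyWeakMixing φ T) (hH : IsUniquelyErgodic φ₁ H)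
    (hAB : DualTensorEq A B) : IsUniquelyErgodic (φ.tensor φ₁) (T.tensor H) := by
  refine ⟨hT.1.tensor hH.1, fun ω hω => State.ext_tmul fun a b => ?_⟩
  rw [State.tensor_tmul]
  refine tendsto_nhds_unique (tendsto_const_nhds.congr' ((eventually_ne_atTop 0).mono fun n hn => ?_))
    ((tendsto_apply_avg_tmul hT hH hAB ω.toCLM a b).trans_eq ?_)
  · change ω _ = ω ((T.tensor H).avg n (MinTensor.tmul a b))
    rw [UCPMap.apply_avg]
    simp only [hω.apply_iter, Finset.sum_const, Finset.card_range, nsmul_eq_mul]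
    rw [inv_mul_cancel_left₀ (Nat.cast_ne_zero.mpr hn)]
  · rw [map_smul]
    change 𝓝 ((φ a * φ₁ b) • ω 1) = _
    rw [ω.apply_one, smul_eq_mul, mul_one]

end Converse

end CStarDyn

theorem mainTheorem3 {A : Type u} [CStarAlgebra A] [PartialOrder A] [StarOrderedRing A]
    (φ : State A) (T : UCPMap A) (hT : IsStatePreserving φ T) :
    ((∀ (B : Type u) [CStarAlgebra B] [PartialOrder B] [StarOrderedRing B]
        (φ₁ : State B) (H : UCPMap B),
        IsUniquelyErgodic φ₁ H → IsUniquelyErgodic (φ.tensor φ₁) (T.tensor H)) →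
      IsStrictlyWeakMixing φ T) ∧
    (IsStrictlyWeakMixing φ T →
      ∀ (B : Type v) [CStarAlgebra B] [PartialOrder B] [StarOrderedRing B]
        (φ₁ : State B) (H : UCPMap B),
        IsUniquelyErgodic φ₁ H → DualTensorEq A B →
        IsUniquelyErgodic (φ.tensor φ₁) (T.tensor H)) := by
  refine ⟨fun h => ?_, fun h B _ _ _ φ₁ H hH hAB => h.isUniquelyErgodic_tensor hH hAB⟩
  -- The functions on a one-point type serve as a copy of `ℂ` in the universe of `A`.
  have hφ : IsUniquelyErgodic φ T := .of_tensor hT (fun _ => rfl)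
    (h _ evalState (UCPMap.id _) isUniquelyErgodic_evalState)
  exact IsUniquelyErgodic.isStrictlyWeakMixing hT (h A φ T hφ)
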